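/- Let $n\in\mathbb N$. For $t>0$ let $\mathrm d\mu_t(z)=\frac{1}{(\pi t)^n}e^{-|z|^2/t}\,\mathrm dv(z)$ be the Gaussian probability measure on $\mathbb C^n$ ($v$ denotes Lebesgue measure), let $H^2_t$ be the Fock space, i.e. the closed subspace of $L^2_t=L^2(\mathbb C^n,\mu_t)$ consisting of the entire functions that are square integrable with respect to $\mu_t$, and let $P^{(t)}\colon L^2_t\to H^2_t$ be the orthogonal projection. For a bounded (measurable) function $f\colon\mathbb C^n\to\mathbb C$ let $T_f^{(t)}\colon H^2_t\to H^2_t$, $T_f^{(t)}u=P^{(t)}(fu)$, be the Toeplitz operator with symbol $f$. Let $C^2_b(\mathbb C^n)$ be the set of functions $f\colon\mathbb C^n\to\mathbb C$ that are twice continuously differentiable (in the real sense) and whose partial derivatives up to order $2$, including $f$ itself, are bounded. Put $\{f,g\}=i\sum_{j=1}^n\left(\partial_jf\,\bar\partial_jg-\bar\partial_jf\,\partial_jg\right)$, where $\partial_j=\frac{\partial}{\partial z_j}$ and $\bar\partial_j=\frac{\partial}{\partial\bar z_j}$, and $[A,B]=AB-BA$. If $f,g\in C^2_b(\mathbb C^n)$,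 then, in the operator norm on $H^2_t$, $$\left\|[T_f^{(t)},T_g^{(t)}]-it\,T_{\{f,g\}}^{(t)}\right\|=o(t)\qquad\text{as } t\to0,\ t>0.$$ -/

import Mathlib

open MeasureTheory Filter Topology
open scoped ENNReal Convolution

noncomputable section

namespace FockToeplitz

/-! ### Bounded differentiable functions, Wirtinger derivatives, Poisson bracket

`ℂⁿ` is `Fin n → ℂ`; its Lebesgue measure `volume` is the product measure. -/

/-- `f ∈ C^k_b(ℂⁿ)`: `f` is `k` times continuously differentiable in the real sense, and all its
derivatives of order at most `k` (order `0` included) are bounded. -/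
def IsCb {n : ℕ} (k : ℕ) (f : (Fin n → ℂ) → ℂ) : Prop :=
  ContDiff ℝ k f ∧ ∀ m ≤ k, ∃ C : ℝ, ∀ z, ‖iteratedFDeriv ℝ m f z‖ ≤ C

/-- `∂f/∂z_j = (∂f/∂x_j - i ∂f/∂y_j) / 2`. -/
def dz {n : ℕ} (j : Fin n) (f : (Fin n → ℂ) → ℂ) (z : Fin n → ℂ) : ℂ :=
  (fderiv ℝ f z (Pi.single j 1) - Complex.I * fderiv ℝ f z (Pi.single j Complex.I)) / 2

/-- `∂f/∂z̄_j = (∂f/∂x_j + i ∂f/∂y_j) / 2`. -/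
def dzbar {n : ℕ} (j : Fin n) (f : (Fin n → ℂ) → ℂ) (z : Fin n → ℂ) : ℂ :=
  (fderiv ℝ f z (Pi.single j 1) + Complex.I * fderiv ℝ f z (Pi.single j Complex.I)) / 2

/-- The Poisson bracket in complex coordinates. -/
def poissonBracket {n : ℕ} (f g : (Fin n → ℂ) → ℂ) (z : Fin n → ℂ) : ℂ :=
  Complex.I * ∑ j : Fin n, (dz j f z * dzbar j g z - dzbar j f z * dz j g z)

/-- A symbol: a bounded measurable function on `ℂⁿ`. -/
def IsSymbol {n : ℕ} (f : (Fin n → ℂ) → ℂ) : Prop :=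
  Measurable f ∧ ∃ C : ℝ, ∀ z, ‖f z‖ ≤ C

theorem IsSymbol.memLp {n : ℕ} {f : (Fin n → ℂ) → ℂ} (hf : IsSymbol f)
    (μ : Measure (Fin n → ℂ)) : MemLp f ∞ μ := by
  obtain ⟨hm, C, hC⟩ := hf
  exact memLp_top_of_bound hm.aestronglyMeasurable C (ae_of_all _ hC)

theorem IsCb.isSymbol {n k : ℕ} {f : (Fin n → ℂ) → ℂ} (hf : IsCb k f) : IsSymbol f := by
  refine ⟨hf.1.continuous.measurable, ?_⟩
  obtain ⟨C, hC⟩ := hf.2 0 (Nat.zero_le _)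
  exact ⟨C, fun z => by simpa using hC z⟩

theorem IsCb.isSymbol_fderiv {n k : ℕ} {f : (Fin n → ℂ) → ℂ} (hf : IsCb k f) (hk : 1 ≤ k)
    (v : Fin n → ℂ) : IsSymbol (fun z => fderiv ℝ f z v) := by
  have hk' : (k : WithTop ℕ∞) ≠ 0 := by
    simpa using Nat.one_le_iff_ne_zero.1 hk
  refine ⟨((hf.1.continuous_fderiv hk').clm_apply continuous_const).measurable, ?_⟩
  obtain ⟨C, hC⟩ := hf.2 1 hk
  refine ⟨C * ‖v‖, fun z => (ContinuousLinearMap.le_opNorm _ _).trans ?_⟩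
  have := hC z
  rw [norm_iteratedFDeriv_one] at this
  gcongr

theorem IsSymbol.add {n : ℕ} {f g : (Fin n → ℂ) → ℂ} (hf : IsSymbol f) (hg : IsSymbol g) :
    IsSymbol (fun z => f z + g z) := by
  obtain ⟨hm, C, hC⟩ := hf
  obtain ⟨hm', D, hD⟩ := hg
  exact ⟨hm.add hm', C + D, fun z => (norm_add_le _ _).trans (add_le_add (hC z) (hD z))⟩

theorem IsSymbol.mul {n : ℕ} {f g : (Fin n → ℂ) → ℂ} (hf : IsSymbol f) (hg : IsSymbol g) :
    IsSymbol (fun z => f z * g z) := by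
  obtain ⟨hm, C, hC⟩ := hf
  obtain ⟨hm', D, hD⟩ := hg
  refine ⟨hm.mul hm', C * D, fun z => ?_⟩
  rw [norm_mul]
  exact mul_le_mul (hC z) (hD z) (norm_nonneg _) ((norm_nonneg _).trans (hC z))

theorem IsSymbol.const {n : ℕ} (c : ℂ) : IsSymbol (fun _ : Fin n → ℂ => c) :=
  ⟨measurable_const, ‖c‖, fun _ => le_rfl⟩

theorem IsSymbol.sub {n : ℕ} {f g : (Fin n → ℂ) → ℂ} (hf : IsSymbol f) (hg : IsSymbol g) :
    IsSymbol (fun z => f z - g z) := by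
  have := hf.add ((IsSymbol.const (-1)).mul hg)
  simpa [sub_eq_add_neg] using this

theorem IsSymbol.sum {n : ℕ} {ι : Type*} (s : Finset ι) {f : ι → (Fin n → ℂ) → ℂ}
    (hf : ∀ i, IsSymbol (f i)) : IsSymbol (fun z => ∑ i ∈ s, f i z) := by
  classical
  induction s using Finset.induction_on with
  | empty => simpa using IsSymbol.const 0
  | insert a s ha ih =>
    simp only [Finset.sum_insert ha]
    exact (hf a).add ih

theorem IsCb.isSymbol_dz {n k : ℕ} {f : (Fin n → ℂ) → ℂ} (hf : IsCb k f) (hk : 1 ≤ k)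
    (j : Fin n) : IsSymbol (dz j f) := by
  have := ((hf.isSymbol_fderiv hk (Pi.single j 1)).sub ((IsSymbol.const Complex.I).mul
    (hf.isSymbol_fderiv hk (Pi.single j Complex.I)))).mul (IsSymbol.const (2⁻¹))
  simp only [← div_eq_mul_inv] at this
  exact this

theorem IsCb.isSymbol_dzbar {n k : ℕ} {f : (Fin n → ℂ) → ℂ} (hf : IsCb k f) (hk : 1 ≤ k)
    (j : Fin n) : IsSymbol (dzbar j f) := by
  have := ((hf.isSymbol_fderiv hk (Pi.single j 1)).add ((IsSymbol.const Complex.I).mul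
    (hf.isSymbol_fderiv hk (Pi.single j Complex.I)))).mul (IsSymbol.const (2⁻¹))
  simp only [← div_eq_mul_inv] at this
  exact this

/-- The Poisson bracket of two `C^1_b` functions is a symbol. -/
theorem isSymbol_poissonBracket {n k : ℕ} {f g : (Fin n → ℂ) → ℂ} (hk : 1 ≤ k)
    (hf : IsCb k f) (hg : IsCb k g) : IsSymbol (poissonBracket f g) :=
  (IsSymbol.const Complex.I).mul <| IsSymbol.sum _ fun j =>
    ((hf.isSymbol_dz hk j).mul (hg.isSymbol_dzbar hk j)).sub
      ((hf.isSymbol_dzbar hk j).mul (hg.isSymbol_dz hk j))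

/-! ### The Gaussian measures and the Fock space -/

/-- The Gaussian density `(π t)⁻ⁿ exp(-|z|² / t)`, with `|z|² = ∑ |z_j|²`. -/
def gaussianDensity (n : ℕ) (t : ℝ) (z : Fin n → ℂ) : ℝ :=
  ((Real.pi * t) ^ n)⁻¹ * Real.exp (-(∑ j, ‖z j‖ ^ 2) / t)

/-- The Gaussian measure `μ_t` (meant for `t > 0`, when it is a probability measure). -/
def gaussian (n : ℕ) (t : ℝ) : Measure (Fin n → ℂ) :=
  volume.withDensity fun z => ENNReal.ofReal (gaussianDensity n t z)

/-- The space `L²_t = L²(ℂⁿ, μ_t)`. -/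
abbrev L2 (n : ℕ) (t : ℝ) : Type := Lp ℂ 2 (gaussian n t)

/-- The elements of `L²(ℂⁿ, μ)` that have an entire representative. -/
def entireLp {n : ℕ} (μ : Measure (Fin n → ℂ)) : Submodule ℂ (Lp ℂ 2 μ) where
  carrier := {φ | ∃ F : (Fin n → ℂ) → ℂ, Differentiable ℂ F ∧ φ =ᵐ[μ] F}
  zero_mem' := ⟨fun _ => 0, differentiable_const _, Lp.coeFn_zero _ _ _⟩
  add_mem' := by
    rintro φ ψ ⟨F, hF, hφ⟩ ⟨G, hG, hψ⟩
    exact ⟨F + G, hF.add hG, (Lp.coeFn_add φ ψ).trans (hφ.add hψ)⟩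
  smul_mem' := by
    rintro c φ ⟨F, hF, hφ⟩
    exact ⟨c • F, hF.const_smul c, (Lp.coeFn_smul c φ).trans (hφ.const_smul c)⟩

/-- The Fock space `H²_t`. -/
def fock (n : ℕ) (t : ℝ) : Submodule ℂ (L2 n t) := entireLp (gaussian n t)

/-! ### The Fock space is closed, so that the orthogonal projection onto it exists -/

/-- A rotation invariant mean value property of entire functions. -/
theorem convolution_entire {n : ℕ} {χ : (Fin n → ℂ) → ℂ} (hχ : Continuous χ)
    (hc : HasCompactSupport χ) (hrot : ∀ (a : Circle) (w : Fin n → ℂ), χ ((a : ℂ) • w) = χ w)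
    (hint : ∫ w, χ w = 1) {F : (Fin n → ℂ) → ℂ} (hF : Differentiable ℂ F) (z : Fin n → ℂ) :
    ∫ w, F w * χ (z - w) = F z := by
  have hFc := hF.continuous
  have h1 : ∫ w, F w * χ (z - w) = ∫ w, F (z - w) * χ w := by
    rw [← integral_sub_left_eq_self _ _ z]
    simp
  have hmp : ∀ a : Circle, MeasurePreserving (fun w : Fin n → ℂ => (a : ℂ) • w) := fun a =>
    volume_preserving_pi (f := fun _ : Fin n => fun x : ℂ => (a : ℂ) * x)
      (fun _ => (rotation a).measurePreserving)
  have hemb : ∀ a : Circle, MeasurableEmbedding (fun w : Fin n → ℂ => (a : ℂ) • w) := fun a =>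
    (Homeomorph.smulOfNeZero (a : ℂ) (Circle.coe_ne_zero a)).measurableEmbedding
  have h2 : ∀ a : Circle, ∫ w, F (z - (a : ℂ) • w) * χ w = ∫ w, F (z - w) * χ w := by
    intro a
    have := (hmp a).integral_comp (hemb a) (fun w => F (z - w) * χ w)
    simpa only [hrot] using this
  have h3 : ∀ w, ∫ θ in (0 : ℝ)..2 * Real.pi, F (z - (Circle.exp θ : ℂ) • w) * χ w
      = (2 * Real.pi) • (F z * χ w) := by
    intro w
    have hd : Differentiable ℂ (fun l : ℂ => F (z - l • w) * χ w) := by fun_prop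
    have := (hd.diffContOnCl (s := Metric.ball 0 |1|)).circleAverage
    rw [Real.circleAverage_def] at this
    simp only [zero_smul, sub_zero] at this
    rw [← this, smul_smul, mul_inv_cancel₀ Real.two_pi_pos.ne', one_smul]
    simp [circleMap, Circle.coe_exp]
  have hcont : Continuous (Function.uncurry fun (θ : ℝ) (w : Fin n → ℂ) =>
      F (z - (Circle.exp θ : ℂ) • w) * χ w) := by
    have : Continuous fun θ : ℝ => ((Circle.exp θ : Circle) : ℂ) := by fun_prop
    unfold Function.uncurry
    fun_prop
  have hI : Integrable (Function.uncurry fun (θ : ℝ) (w : Fin n → ℂ) =>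
      F (z - (Circle.exp θ : ℂ) • w) * χ w)
      ((volume.restrict (Set.uIoc 0 (2 * Real.pi))).prod volume) := by
    have hK : IsCompact (Set.uIcc (0 : ℝ) (2 * Real.pi) ×ˢ tsupport χ) :=
      isCompact_uIcc.prod hc
    have h := hcont.continuousOn.integrableOn_compact (μ := volume.prod volume) hK
    have h' : IntegrableOn (Function.uncurry fun (θ : ℝ) (w : Fin n → ℂ) =>
        F (z - (Circle.exp θ : ℂ) • w) * χ w)
        (Set.uIoc (0 : ℝ) (2 * Real.pi) ×ˢ Set.univ) (volume.prod volume) := by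
      refine IntegrableOn.of_forall_sdiff_eq_zero
        (s := Set.uIcc (0 : ℝ) (2 * Real.pi) ×ˢ tsupport χ) h
        (measurableSet_uIoc.prod MeasurableSet.univ) ?_
      rintro ⟨θ, w⟩ ⟨⟨hθ, -⟩, hn⟩
      have hw : w ∉ tsupport χ := fun hw => hn ⟨Set.uIoc_subset_uIcc hθ, hw⟩
      simp [Function.uncurry, image_eq_zero_of_notMem_tsupport hw]
    rw [IntegrableOn, ← Measure.prod_restrict, Measure.restrict_univ] at h'
    exact h'
  have h4 := intervalIntegral_integral_swap hI
  simp only [h2, h3] at h4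
  rw [intervalIntegral.integral_const, sub_zero, integral_smul, integral_const_mul, hint,
    mul_one] at h4
  rw [h1]
  exact smul_right_injective ℂ Real.two_pi_pos.ne' h4

/-- A smooth, compactly supported, rotation invariant function of integral one. -/
theorem exists_kernel (n : ℕ) : ∃ χ : (Fin n → ℂ) → ℂ, ContDiff ℝ 1 χ ∧ HasCompactSupport χ ∧
    (∀ (a : Circle) (w : Fin n → ℂ), χ ((a : ℂ) • w) = χ w) ∧ ∫ w, χ w = 1 := by
  let p : (Fin n → ℂ) → ℝ := fun w => Real.smoothTransition (1 - ∑ j, ‖w j‖ ^ 2)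
  have hp : ContDiff ℝ 1 p := by
    refine Real.smoothTransition.contDiff.comp ?_
    refine contDiff_const.sub (ContDiff.sum fun j _ => ?_)
    exact (contDiff_apply ℝ ℂ j).norm_sq ℝ
  have hc : HasCompactSupport p := by
    refine HasCompactSupport.intro (isCompact_closedBall (0 : Fin n → ℂ) 1) fun w hw => ?_
    refine Real.smoothTransition.zero_of_nonpos ?_
    rw [mem_closedBall_zero_iff, pi_norm_le_iff_of_nonneg zero_le_one] at hw
    push Not at hw
    obtain ⟨j, hj⟩ := hw
    have h1 : ‖w j‖ ^ 2 ≤ ∑ j, ‖w j‖ ^ 2 :=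
      Finset.single_le_sum (f := fun j => ‖w j‖ ^ 2) (fun i _ => sq_nonneg _) (Finset.mem_univ j)
    nlinarith
  have hpos : 0 < ∫ w, p w := by
    refine hp.continuous.integral_pos_of_hasCompactSupport_nonneg_nonzero hc
      (fun w => Real.smoothTransition.nonneg _) (x := 0) ?_
    simp [p]
  refine ⟨fun w => (((∫ w, p w)⁻¹ * p w : ℝ) : ℂ), ?_, ?_, ?_, ?_⟩
  · exact Complex.ofRealCLM.contDiff.comp (contDiff_const.mul hp)
  · refine hc.comp_left (g := fun x : ℝ => (((∫ w, p w)⁻¹ * x : ℝ) : ℂ)) ?_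
    simp
  · intro a w
    simp only [p, Pi.smul_apply, norm_smul, Circle.norm_coe, one_mul]
  · change ∫ w, (((∫ w, p w)⁻¹ * p w : ℝ) : ℂ) = 1
    rw [integral_complex_ofReal, integral_const_mul, inv_mul_cancel₀ hpos.ne']
    simp

theorem isClosed_entireLp {n : ℕ} {ρ : (Fin n → ℂ) → ℝ} (hρ : Continuous ρ) (hpos : ∀ z, 0 < ρ z) :
    IsClosed (entireLp (volume.withDensity fun z => ENNReal.ofReal (ρ z)) :
      Set (Lp ℂ 2 (volume.withDensity fun z => ENNReal.ofReal (ρ z)))) := by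
  set μ : Measure (Fin n → ℂ) := volume.withDensity fun z => ENNReal.ofReal (ρ z) with hμ
  have hfin : IsLocallyFiniteMeasure μ := by
    have := IsLocallyFiniteMeasure.withDensity_ofReal (μ := (volume : Measure (Fin n → ℂ))) hρ
    exact this
  have hac : μ ≪ volume := withDensity_absolutelyContinuous _ _
  have hac' : (volume : Measure (Fin n → ℂ)) ≪ μ :=
    withDensity_absolutelyContinuous' hρ.measurable.ennreal_ofReal.aemeasurable
      (ae_of_all _ fun z => by simpa using hpos z)
  have hsm : ∀ h : (Fin n → ℂ) → ℂ, ∫ w, h w ∂μ = ∫ w, ρ w • h w := by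
    intro h
    rw [hμ, integral_withDensity_eq_integral_toReal_smul hρ.measurable.ennreal_ofReal
      (ae_of_all _ fun _ => ENNReal.ofReal_lt_top)]
    simp only [ENNReal.toReal_ofReal (hpos _).le]
  have hloc : ∀ φ : Lp ℂ 2 μ, LocallyIntegrable φ volume := by
    intro φ
    have h1 : LocallyIntegrable φ μ := (Lp.memLp φ).locallyIntegrable (by norm_num)
    generalize (φ : (Fin n → ℂ) → ℂ) = φ at h1 ⊢
    rw [locallyIntegrable_iff] at h1 ⊢
    intro K hK
    have h2 := h1 K hK
    rw [IntegrableOn, hμ, restrict_withDensity hK.measurableSet,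
      integrable_withDensity_iff_integrable_smul' hρ.measurable.ennreal_ofReal
      (ae_of_all _ fun _ => ENNReal.ofReal_lt_top)] at h2
    simp only [ENNReal.toReal_ofReal (hpos _).le] at h2
    have h3 := IntegrableOn.continuousOn_smul (𝕜 := ℝ) (f := fun z => (ρ z)⁻¹)
      (g := fun z => ρ z • φ z) (K := K) h2
      (hρ.inv₀ fun z => (hpos z).ne').continuousOn hK
    refine h3.congr (ae_of_all _ fun z => ?_)
    simp only [smul_smul]
    rw [inv_mul_cancel₀ (hpos z).ne', one_smul]
  have hlim : ∀ η : (Fin n → ℂ) → ℂ, Continuous η → HasCompactSupport η → ∀ z,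
      Continuous fun φ : Lp ℂ 2 μ => ∫ w, φ w * η (z - w) := by
    intro η hη hηc z
    let h : (Fin n → ℂ) → ℂ := fun w => (starRingEnd ℂ) (((ρ w)⁻¹ : ℝ) * η (z - w))
    have hh : Continuous h := by
      have : Continuous fun w => (ρ w)⁻¹ := hρ.inv₀ fun z => (hpos z).ne'
      fun_prop
    have hhc : HasCompactSupport h := by
      have h0 : HasCompactSupport fun w => η (z - w) :=
        hηc.comp_homeomorph (Homeomorph.subLeft z)
      exact (h0.mul_left (f := fun w => (((ρ w)⁻¹ : ℝ) : ℂ))).comp_left (map_zero _)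
    have hL : MemLp h 2 μ := hh.memLp_of_hasCompactSupport hhc
    have : (fun φ : Lp ℂ 2 μ => ∫ w, φ w * η (z - w)) = fun φ => inner ℂ (hL.toLp h) φ := by
      funext φ
      rw [L2.inner_def]
      have e : (fun w => inner ℂ ((hL.toLp h : Lp ℂ 2 μ) w) (φ w)) =ᵐ[μ]
          fun w => φ w * ((((ρ w)⁻¹ : ℝ) : ℂ) * η (z - w)) := by
        filter_upwards [hL.coeFn_toLp] with w hw
        rw [hw]
        simp [h, RCLike.inner_apply]
      rw [integral_congr_ae e, hsm]
      refine integral_congr_ae (ae_of_all _ fun w => ?_)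
      have : (ρ w : ℂ) ≠ 0 := by exact_mod_cast (hpos w).ne'
      simp only [Complex.real_smul, Complex.ofReal_inv]
      field_simp
    rw [this]
    fun_prop
  obtain ⟨χ, hχ, hχc, hχr, hχi⟩ := exists_kernel n
  refine isClosed_of_closure_subset fun φ hφ => ?_
  obtain ⟨u, hu, hut⟩ := mem_closure_iff_seq_limit.1 hφ
  choose F hF huF using hu
  let L := ContinuousLinearMap.mul ℝ ℂ
  let Φ : (Fin n → ℂ) → ℂ := (φ : (Fin n → ℂ) → ℂ) ⋆[L] χ
  have hΦ : ∀ ψ : Lp ℂ 2 μ, ∀ z, HasFDerivAt ((ψ : (Fin n → ℂ) → ℂ) ⋆[L] χ)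
      (((ψ : (Fin n → ℂ) → ℂ) ⋆[L.precompR (Fin n → ℂ)] fderiv ℝ χ) z) z := fun ψ z =>
    hχc.hasFDerivAt_convolution_right L (hloc ψ) hχ z
  have hconvF : ∀ k z, ((u k : (Fin n → ℂ) → ℂ) ⋆[L] χ) z = F k z := by
    intro k z
    rw [← convolution_entire hχ.continuous hχc hχr hχi (hF k) z]
    refine integral_congr_ae ?_
    filter_upwards [hac'.ae_le (huF k)] with w hw
    simp only [L, ContinuousLinearMap.mul_apply', hw]
  have htend : ∀ z, Tendsto (fun k => F k z) atTop (𝓝 (Φ z)) := by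
    intro z
    have := ((hlim χ hχ.continuous hχc z).tendsto φ).comp hut
    refine this.congr fun k => ?_
    exact hconvF k z
  have hderiv : ∀ z v, Tendsto (fun k => fderiv ℂ (F k) z v) atTop
      (𝓝 ((((φ : (Fin n → ℂ) → ℂ) ⋆[L.precompR (Fin n → ℂ)] fderiv ℝ χ) z) v)) := by
    intro z v
    have hc1 : Continuous (fderiv ℝ χ) := hχ.continuous_fderiv one_ne_zero
    have hc2 : HasCompactSupport (fderiv ℝ χ) := hχc.fderiv ℝ
    have hc3 : HasCompactSupport fun a => fderiv ℝ χ a v :=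
      hc2.comp_left (g := fun T : (Fin n → ℂ) →L[ℝ] ℂ => T v) rfl
    have := ((hlim (fun a => fderiv ℝ χ a v) (hc1.clm_apply continuous_const) hc3 z).tendsto
      φ).comp hut
    rw [convolution_precompR_apply L (hloc φ) hc2 hc1]
    refine this.congr fun k => ?_
    have e1 := hΦ (u k) z
    have e2 : ((u k : (Fin n → ℂ) → ℂ) ⋆[L] χ) = F k := funext (hconvF k)
    rw [e2] at e1
    have e3 := ((hF k z).hasFDerivAt.restrictScalars ℝ).unique e1
    have e4 := congrArg (fun T : (Fin n → ℂ) →L[ℝ] ℂ => T v) e3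
    simp only [ContinuousLinearMap.coe_restrictScalars'] at e4
    rw [e4, convolution_precompR_apply L (hloc _) hc2 hc1]
    rfl
  refine ⟨Φ, fun z => ?_, ?_⟩
  · have hd := hΦ φ z
    rw [differentiableAt_iff_restrictScalars ℝ hd.differentiableAt, hd.fderiv]
    set D := ((φ : (Fin n → ℂ) → ℂ) ⋆[L.precompR (Fin n → ℂ)] fderiv ℝ χ) z with hD
    have hsmul : ∀ (c : ℂ) (v : Fin n → ℂ), D (c • v) = c • D v := by
      intro c v
      refine tendsto_nhds_unique (hderiv z (c • v)) ?_
      simp only [map_smul]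
      exact (hderiv z v).const_smul c
    exact ⟨{ D with map_smul' := hsmul, cont := D.cont }, rfl⟩
  · obtain ⟨ns, hns, hae⟩ := (tendstoInMeasure_of_tendsto_Lp hut).exists_seq_tendsto_ae
    have hall : ∀ᵐ z ∂μ, ∀ k, u k z = F k z := ae_all_iff.2 huF
    filter_upwards [hae, hall] with z h1 h2
    refine tendsto_nhds_unique h1 ?_
    simp only [h2]
    exact (htend z).comp hns.tendsto_atTop

theorem isClosed_fock (n : ℕ) (t : ℝ) : IsClosed (fock n t : Set (L2 n t)) := by
  by_cases h : 0 < ((Real.pi * t) ^ n)⁻¹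
  · refine isClosed_entireLp (ρ := gaussianDensity n t) ?_ fun z => mul_pos h (Real.exp_pos _)
    unfold gaussianDensity
    fun_prop
  · have h0 : gaussian n t = 0 := by
      have : ∀ z, ENNReal.ofReal (gaussianDensity n t z) = 0 := fun z =>
        ENNReal.ofReal_of_nonpos
          (mul_nonpos_of_nonpos_of_nonneg (not_lt.1 h) (Real.exp_pos _).le)
      simp only [gaussian, this]
      exact withDensity_zero
    have : (fock n t : Set (L2 n t)) = Set.univ := by
      refine Set.eq_univ_of_forall fun φ => ⟨fun _ => 0, differentiable_const _, ?_⟩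
      have hbot : ae (gaussian n t) = ⊥ := by rw [h0, ae_zero]
      change ∀ᵐ z ∂(gaussian n t), _
      simp [hbot]
    rw [this]
    exact isClosed_univ

instance (n : ℕ) (t : ℝ) : CompleteSpace (fock n t) :=
  (isClosed_fock n t).completeSpace_coe

/-! ### Toeplitz operators -/

/-- The multiplication operator `M_f` on `L²_t`. -/
def mulOp (n : ℕ) (t : ℝ) (f : (Fin n → ℂ) → ℂ) (hf : IsSymbol f) : L2 n t →L[ℂ] L2 n t :=
  (ContinuousLinearMap.mul ℂ ℂ).holderL (gaussian n t) ∞ 2 2 ((hf.memLp (gaussian n t)).toLp f)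

/-- The Toeplitz operator `T_f^{(t)} = P^{(t)} M_f` on `H²_t`, where `P^{(t)}` is the orthogonal
projection of `L²_t` onto `H²_t`. -/
def toeplitz (n : ℕ) (t : ℝ) (f : (Fin n → ℂ) → ℂ) (hf : IsSymbol f) :
    fock n t →L[ℂ] fock n t :=
  (fock n t).orthogonalProjectionOnto ∘L mulOp n t f hf ∘L (fock n t).subtypeL

end FockToeplitz

end

noncomputable section

namespace FockToeplitz

/-! ### Gaussian integrals -/

/-! The proof gives more than is claimed: `T_f T_g = T_{fg} - t T_W + O(t²)` with `W = ∑ ∂_j f ∂̄_j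
g`. Exchanging `f` and `g` and subtracting removes `T_{fg}`. Since `{f,g} = i (W(f,g) - W(g,f))`,
the terms linear in `t` are exactly `it T_{{f,g}}`.

For `u, v` in the Fock space, `⟨v, T_f T_g u⟩` pairs `P(g u)` with `f̄ v`, so a second order
expansion of the projection `P` is needed. The identity is joined to `P` by the forms `B_θ`
(`heatForm`), `0 < θ ≤ t`; formally `B_θ` belongs to `(1 - θ/t)^N`, with `N = t ∑ ∂̄_j^* ∂̄_j` the
number operator. Four facts carry the argument: (1) `B_θ` tends to the inner product as `θ → 0`
(`tendsto_heatForm`); (2) `B_t(φ, ψ)` pairs `P φ` with `ψ`, by the Bergman kernel formula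
(`integral_bergman_eq_heatForm`); (3) `d/dθ B_θ(φ, ψ) = -∑ B_θ(∂̄_j φ, ∂̄_j ψ)`, by two integrations
by parts (`hasDerivAt_heatForm`); (4) `B_θ` is bounded on `L²_t` uniformly in `θ` and `t`
(`norm_heatForm_le`). Using (3) twice gives `⟨φ, ψ⟩ - t ∑ ⟨∂̄_j φ, ∂̄_j ψ⟩`, with an error `O(t²)`
governed by the `L²_t` norms of the second `∂̄` derivatives (`norm_heatForm_sub_taylor_le`).

For `φ = g u` and `ψ = f̄ v` every `∂̄` falls on the symbol, because `u` and `v` are holomorphic. So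
the linear term is `T_W`, and the error involves only sup norms of second derivatives of the symbols
times `‖u‖² + ‖v‖²`.

The integrations by parts are done for compactly supported symbols. Cutoffs with uniformly bounded
derivatives and strong operator convergence extend the estimate to `C²_b`. -/

theorem gaussianDensity_eq_prod (n : ℕ) (t : ℝ) (z : Fin n → ℂ) :
    gaussianDensity n t z = ∏ j, ((Real.pi * t)⁻¹ * Real.exp (-t⁻¹ * ‖z j‖ ^ 2)) := by
  rw [Finset.prod_mul_distrib, ← Real.exp_sum, gaussianDensity, ← Finset.mul_sum]
  simp [div_eq_inv_mul, mul_pow, mul_comm]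

theorem continuous_gaussianDensity (n : ℕ) (t : ℝ) : Continuous (gaussianDensity n t) := by
  unfold gaussianDensity
  fun_prop

theorem gaussianDensity_pos (n : ℕ) {t : ℝ} (ht : 0 < t) (z : Fin n → ℂ) :
    0 < gaussianDensity n t z := by
  unfold gaussianDensity
  positivity

theorem gaussianDensity_neg (n : ℕ) (t : ℝ) (z : Fin n → ℂ) :
    gaussianDensity n t (-z) = gaussianDensity n t z := by
  simp [gaussianDensity]

theorem integrable_gaussianDensity (n : ℕ) {t : ℝ} (ht : 0 < t) :
    Integrable (gaussianDensity n t) := by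
  have h1 : Integrable fun x : ℂ => (Real.pi * t)⁻¹ * Real.exp (-t⁻¹ * ‖x‖ ^ 2) := by
    have h := (GaussianFourier.integrable_cexp_neg_mul_sq_norm_add (V := ℂ)
      (b := ((t⁻¹ : ℝ) : ℂ)) (by simpa using ht) 0 0).norm
    refine (h.congr (ae_of_all _ fun x => ?_)).const_mul _
    simp [Complex.norm_exp, ← Complex.ofReal_pow]
  rw [funext (gaussianDensity_eq_prod n t)]
  exact Integrable.fintype_prod fun _ => h1

theorem integral_gaussianDensity (n : ℕ) {t : ℝ} (ht : 0 < t) :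
    ∫ z, gaussianDensity n t z = 1 := by
  simp only [gaussianDensity_eq_prod]
  rw [integral_fintype_prod_volume_eq_pow (fun x : ℂ => (Real.pi * t)⁻¹ *
    Real.exp (-t⁻¹ * ‖x‖ ^ 2)), integral_const_mul,
    GaussianFourier.integral_rexp_neg_mul_sq_norm (inv_pos.2 ht)]
  have : Real.pi * t ≠ 0 := by positivity
  simp only [div_inv_eq_mul, Complex.finrank_real_complex, Nat.cast_ofNat, div_self_of_invertible,
    Real.rpow_one, inv_mul_cancel₀ this, one_pow]

theorem integrable_gaussianDensity_sub_mul (n : ℕ) {t : ℝ} (ht : 0 < t) {a : (Fin n → ℂ) → ℝ}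
    (ha : Integrable a) :
    Integrable fun p : (Fin n → ℂ) × (Fin n → ℂ) => gaussianDensity n t (p.1 - p.2) * a p.2 := by
  have := Integrable.convolution_integrand (ContinuousLinearMap.mul ℝ ℝ) ha
    (integrable_gaussianDensity n ht)
  refine this.congr (ae_of_all _ fun p => ?_)
  simp [mul_comm]

/-- Convolution with a kernel of mass one preserves the integral. This lemma and its mirror image
below are the two marginals of a Schur test. -/
theorem integral_gaussianDensity_sub_mul (n : ℕ) {t : ℝ} (ht : 0 < t) {a : (Fin n → ℂ) → ℝ}
    (ha : Integrable a) :
    ∫ p : (Fin n → ℂ) × (Fin n → ℂ), gaussianDensity n t (p.1 - p.2) * a p.2 = ∫ z, a z := by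
  have h := integral_convolution (μ := (volume : Measure (Fin n → ℂ)))
    (ν := (volume : Measure (Fin n → ℂ))) (ContinuousLinearMap.mul ℝ ℝ) ha
    (integrable_gaussianDensity n ht)
  rw [integral_gaussianDensity n ht] at h
  simp only [ContinuousLinearMap.mul_apply', mul_one] at h
  rw [← h, Measure.volume_eq_prod, integral_prod _ (integrable_gaussianDensity_sub_mul n ht ha)]
  simp [convolution, mul_comm]

theorem integrable_gaussianDensity_sub_mul' (n : ℕ) {t : ℝ} (ht : 0 < t) {a : (Fin n → ℂ) → ℝ}
    (ha : Integrable a) :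
    Integrable fun p : (Fin n → ℂ) × (Fin n → ℂ) => gaussianDensity n t (p.1 - p.2) * a p.1 := by
  refine (integrable_gaussianDensity_sub_mul n ht ha).swap.congr (ae_of_all _ fun p => ?_)
  simp [← gaussianDensity_neg n t (p.1 - p.2)]

theorem integral_gaussianDensity_sub_mul' (n : ℕ) {t : ℝ} (ht : 0 < t) {a : (Fin n → ℂ) → ℝ}
    (ha : Integrable a) :
    ∫ p : (Fin n → ℂ) × (Fin n → ℂ), gaussianDensity n t (p.1 - p.2) * a p.1 = ∫ z, a z := by
  rw [← integral_gaussianDensity_sub_mul n ht ha, Measure.volume_eq_prod, ← integral_prod_swap]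
  refine integral_congr_ae (ae_of_all _ fun p => ?_)
  simp [← gaussianDensity_neg n t (p.1 - p.2)]

theorem integral_gaussian {E : Type*} [NormedAddCommGroup E] [NormedSpace ℝ E] (n : ℕ) {t : ℝ}
    (ht : 0 < t) (h : (Fin n → ℂ) → E) :
    ∫ z, h z ∂(gaussian n t) = ∫ z, gaussianDensity n t z • h z := by
  rw [gaussian, integral_withDensity_eq_integral_toReal_smul
    (continuous_gaussianDensity n t).measurable.ennreal_ofReal
    (ae_of_all _ fun _ => ENNReal.ofReal_lt_top)]
  simp only [ENNReal.toReal_ofReal (gaussianDensity_pos n ht _).le]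

theorem integrable_gaussian_iff {E : Type*} [NormedAddCommGroup E] [NormedSpace ℝ E] (n : ℕ)
    {t : ℝ} (ht : 0 < t) (h : (Fin n → ℂ) → E) :
    Integrable h (gaussian n t) ↔ Integrable fun z => gaussianDensity n t z • h z := by
  rw [gaussian, integrable_withDensity_iff_integrable_smul'
    (continuous_gaussianDensity n t).measurable.ennreal_ofReal
    (ae_of_all _ fun _ => ENNReal.ofReal_lt_top)]
  simp only [ENNReal.toReal_ofReal (gaussianDensity_pos n ht _).le]

theorem isProbabilityMeasure_gaussian (n : ℕ) {t : ℝ} (ht : 0 < t) :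
    IsProbabilityMeasure (gaussian n t) := by
  constructor
  rw [gaussian, withDensity_apply _ MeasurableSet.univ, Measure.restrict_univ,
    ← ofReal_integral_eq_lintegral_ofReal (integrable_gaussianDensity n ht)
      (ae_of_all _ fun z => (gaussianDensity_pos n ht z).le), integral_gaussianDensity n ht,
    ENNReal.ofReal_one]

/-! ### The interpolating family of forms -/

/-- The kernel of the interpolation, for `0 < θ ≤ t`, between the identity (`θ → 0`) and the
orthogonal projection onto the Fock space (`θ = t`). -/
def heatKernel (n : ℕ) (t θ : ℝ) (p : (Fin n → ℂ) × (Fin n → ℂ)) : ℂ :=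
  gaussianDensity n θ (p.1 - p.2) * Complex.exp (-(∑ k, star (p.1 k) * p.2 k) / t)

/-- The sesquilinear form `⟨ψ, φ⟩` smoothed by `heatKernel`. -/
def heatForm (n : ℕ) (t θ : ℝ) (φ ψ : (Fin n → ℂ) → ℂ) : ℂ :=
  ((((Real.pi * t) ^ n)⁻¹ : ℝ) : ℂ) *
    ∫ p : (Fin n → ℂ) × (Fin n → ℂ), heatKernel n t θ p * (φ p.2 * star (ψ p.1))

/-- The modulus of `exp(-z̄·w/t)` is `exp((|z-w|² - |z|² - |w|²)/(2t))`. Its growth in `|z-w|` costs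
at most half of the exponent of the Gaussian of parameter `θ`, and the rest is the square root of
the Gaussian weight at each of the two points. The factor `2^n` comes from the normalisations at `θ`
and `2θ`. -/
theorem norm_heatKernel_le (n : ℕ) {t θ : ℝ} (hθ : 0 < θ) (hθt : θ ≤ t)
    (p : (Fin n → ℂ) × (Fin n → ℂ)) :
    ‖heatKernel n t θ p‖ ≤ 2 ^ n * (gaussianDensity n (2 * θ) (p.1 - p.2) *
      (Real.exp (-(∑ j, ‖p.1 j‖ ^ 2) / (2 * t)) * Real.exp (-(∑ j, ‖p.2 j‖ ^ 2) / (2 * t)))) := by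
  have ht : 0 < t := hθ.trans_le hθt
  have hre : (-(∑ k, star (p.1 k) * p.2 k) / (t : ℂ)).re =
      ((∑ j, ‖(p.1 - p.2) j‖ ^ 2) - (∑ j, ‖p.1 j‖ ^ 2) - ∑ j, ‖p.2 j‖ ^ 2) / (2 * t) := by
    rw [Complex.div_ofReal_re, Complex.neg_re, Complex.re_sum, ← Finset.sum_sub_distrib,
      ← Finset.sum_sub_distrib, ← Finset.sum_neg_distrib, Finset.sum_div, Finset.sum_div]
    refine Finset.sum_congr rfl fun k _ => ?_
    simp only [Pi.sub_apply, ← Complex.normSq_eq_norm_sq, Complex.normSq_apply]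
    simp
    field_simp
    ring
  rw [heatKernel, norm_mul, Complex.norm_exp, hre, Complex.norm_real, Real.norm_eq_abs,
    abs_of_pos (gaussianDensity_pos n hθ _)]
  set S := ∑ j, ‖(p.1 - p.2) j‖ ^ 2 with hS
  set a := ∑ j, ‖p.1 j‖ ^ 2
  set b := ∑ j, ‖p.2 j‖ ^ 2
  have hS0 : 0 ≤ S := Finset.sum_nonneg fun _ _ => sq_nonneg _
  have e : (2 : ℝ) ^ n * ((Real.pi * (2 * θ)) ^ n)⁻¹ = ((Real.pi * θ) ^ n)⁻¹ := by
    rw [← inv_pow, ← mul_pow, ← inv_pow]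
    congr 1
    have := Real.pi_pos
    field_simp
  simp only [gaussianDensity, ← hS]
  rw [← mul_assoc, ← mul_assoc (2 ^ n), e, mul_assoc, mul_assoc, ← Real.exp_add, ← Real.exp_add,
    ← Real.exp_add]
  -- The comparison of the two exponents rests on `θ ≤ t`.
  have : S / (2 * t) ≤ S / (2 * θ) := by gcongr
  refine mul_le_mul_of_nonneg_left (Real.exp_le_exp.2 ?_) (by positivity)
  have h1 : -S / θ = - (2 * (S / (2 * θ))) := by field_simp
  have h2 : -S / (2 * θ) = -(S / (2 * θ)) := by ring
  have h3 : (S - a - b) / (2 * t) = S / (2 * t) + (-a / (2 * t) + -b / (2 * t)) := by ring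
  rw [h1, h2, h3]
  linarith

/-- Schur test: the pointwise kernel bound, then `ab ≤ (a² + b²)/2`, then the unit marginals of the
Gaussian of parameter `2θ`. The constant depends on neither `θ` nor `t`, which is what makes the
Taylor remainder uniform. -/
theorem norm_heatForm_le (n : ℕ) {t θ : ℝ} (hθ : 0 < θ) (hθt : θ ≤ t) {φ ψ : (Fin n → ℂ) → ℂ}
    (hφ : Integrable (fun z => ‖φ z‖ ^ 2) (gaussian n t))
    (hψ : Integrable (fun z => ‖ψ z‖ ^ 2) (gaussian n t)) :
    ‖heatForm n t θ φ ψ‖ ≤ 2 ^ n / 2 *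
      ((∫ z, ‖φ z‖ ^ 2 ∂(gaussian n t)) + ∫ z, ‖ψ z‖ ^ 2 ∂(gaussian n t)) := by
  have ht : 0 < t := hθ.trans_le hθt
  have h2θ : 0 < 2 * θ := by positivity
  rw [integrable_gaussian_iff n ht] at hφ hψ
  rw [integral_gaussian n ht, integral_gaussian n ht]
  simp only [smul_eq_mul] at *
  have hc : 0 < ((Real.pi * t) ^ n)⁻¹ := by positivity
  have hsq : ∀ z : Fin n → ℂ, gaussianDensity n t z =
      ((Real.pi * t) ^ n)⁻¹ * Real.exp (-(∑ j, ‖z j‖ ^ 2) / (2 * t)) ^ 2 := by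
    intro z
    rw [gaussianDensity, ← Real.exp_nat_mul]
    congr 2
    push_cast
    field_simp
  have i1 := integrable_gaussianDensity_sub_mul n h2θ hφ
  have i2 := integrable_gaussianDensity_sub_mul' n h2θ hψ
  have key := norm_integral_le_of_norm_le (μ := volume)
    (f := fun p : (Fin n → ℂ) × (Fin n → ℂ) =>
      ((((Real.pi * t) ^ n)⁻¹ : ℝ) : ℂ) * (heatKernel n t θ p * (φ p.2 * star (ψ p.1))))
    ((i1.add i2).const_mul (2 ^ n / 2)) (ae_of_all _ fun p => ?_)
  · rw [integral_const_mul, integral_const_mul] at key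
    refine key.trans (le_of_eq ?_)
    congr 1
    simp only [Pi.add_apply]
    rw [integral_add i1 i2, integral_gaussianDensity_sub_mul n h2θ hφ,
      integral_gaussianDensity_sub_mul' n h2θ hψ]
  · rw [norm_mul, norm_mul, norm_mul, norm_star, Complex.norm_real, Real.norm_eq_abs,
      abs_of_pos hc]
    have hk := norm_heatKernel_le n hθ hθt p
    simp only [Pi.add_apply]
    rw [hsq p.1, hsq p.2]
    set A := Real.exp (-(∑ j, ‖p.1 j‖ ^ 2) / (2 * t))
    set B := Real.exp (-(∑ j, ‖p.2 j‖ ^ 2) / (2 * t))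
    set G := gaussianDensity n (2 * θ) (p.1 - p.2)
    have hG : 0 < G := gaussianDensity_pos n h2θ _
    calc ((Real.pi * t) ^ n)⁻¹ * (‖heatKernel n t θ p‖ * (‖φ p.2‖ * ‖ψ p.1‖))
        ≤ ((Real.pi * t) ^ n)⁻¹ * (2 ^ n * (G * (A * B)) * (‖φ p.2‖ * ‖ψ p.1‖)) := by gcongr
      _ = ((Real.pi * t) ^ n)⁻¹ * 2 ^ n * G * ((A * ‖ψ p.1‖) * (B * ‖φ p.2‖)) := by ring
      _ ≤ ((Real.pi * t) ^ n)⁻¹ * 2 ^ n * G *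
          (((A * ‖ψ p.1‖) ^ 2 + (B * ‖φ p.2‖) ^ 2) / 2) := by
        gcongr
        nlinarith [sq_nonneg (A * ‖ψ p.1‖ - B * ‖φ p.2‖)]
      _ = _ := by ring

/-! ### The evolution equation of the interpolating forms -/

instance isAddHaarMeasure_volume_prod (n : ℕ) :
    (volume : Measure ((Fin n → ℂ) × (Fin n → ℂ))).IsAddHaarMeasure := by
  have : (volume : Measure (Fin n → ℂ)).IsAddHaarMeasure := inferInstance
  exact Measure.prod.instIsAddHaarMeasure _ _

/-- Integration by parts for `∂_{v₁} + c ∂_{v₂}`. With `c = i` or `c = -i` and the directions `1`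
and `i` of one coordinate this is, up to the factor `1/2`, a Wirtinger derivative. Compact support
of `G` alone removes every boundary term. -/
theorem integral_mul_lineDeriv_add {V : Type*} [NormedAddCommGroup V] [NormedSpace ℝ V]
    [FiniteDimensional ℝ V] [MeasurableSpace V] [BorelSpace V] {μ : Measure V}
    [μ.IsAddHaarMeasure] {K K₁ K₂ G G₁ G₂ : V → ℂ} {v₁ v₂ : V} (c : ℂ)
    (hK : Continuous K) (hK₁ : Continuous K₁) (hK₂ : Continuous K₂)
    (hG : Continuous G) (hG₁ : Continuous G₁) (hG₂ : Continuous G₂)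
    (cG : HasCompactSupport G) (cG₁ : HasCompactSupport G₁) (cG₂ : HasCompactSupport G₂)
    (dK₁ : ∀ x, HasLineDerivAt ℝ K (K₁ x) x v₁) (dK₂ : ∀ x, HasLineDerivAt ℝ K (K₂ x) x v₂)
    (dG₁ : ∀ x, HasLineDerivAt ℝ G (G₁ x) x v₁) (dG₂ : ∀ x, HasLineDerivAt ℝ G (G₂ x) x v₂) :
    ∫ x, K x * (G₁ x + c * G₂ x) ∂μ = -∫ x, (K₁ x + c * K₂ x) * G x ∂μ := by
  have int : ∀ {A B : V → ℂ}, Continuous A → Continuous B → HasCompactSupport B →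
      Integrable (fun x => A x * B x) μ := fun hA hB cB =>
    (hA.mul hB).integrable_of_hasCompactSupport cB.mul_left
  have p₁ := integral_bilinear_hasLineDerivAt_right_eq_neg_left_of_integrable (μ := μ)
    (B := ContinuousLinearMap.mul ℝ ℂ) (int hK₁ hG cG) (int hK hG₁ cG₁) (int hK hG cG)
    (fun x _ => dK₁ x) (fun x _ => dG₁ x)
  have p₂ := integral_bilinear_hasLineDerivAt_right_eq_neg_left_of_integrable (μ := μ)
    (B := ContinuousLinearMap.mul ℝ ℂ) (int hK₂ hG cG) (int hK hG₂ cG₂) (int hK hG cG)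
    (fun x _ => dK₂ x) (fun x _ => dG₂ x)
  simp only [ContinuousLinearMap.mul_apply'] at p₁ p₂
  have e₁ : ∀ x, K x * (G₁ x + c * G₂ x) = K x * G₁ x + c * (K x * G₂ x) := fun x => by ring
  have e₂ : ∀ x, (K₁ x + c * K₂ x) * G x = K₁ x * G x + c * (K₂ x * G x) := fun x => by ring
  simp only [e₁, e₂]
  rw [integral_add (int hK hG₁ cG₁) ((int hK hG₂ cG₂).const_mul c),
    integral_add (int hK₁ hG cG) ((int hK₂ hG cG).const_mul c), integral_const_mul,
    integral_const_mul, p₁, p₂]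
  ring

/-- With the norms replaced by `z * star z`, the exponent is polynomial in the coordinates and their
conjugates, ready for differentiation. -/
theorem heatKernel_eq (n : ℕ) (t θ : ℝ) (p : (Fin n → ℂ) × (Fin n → ℂ)) :
    heatKernel n t θ p = ((((Real.pi * θ) ^ n)⁻¹ : ℝ) : ℂ) *
      Complex.exp (-∑ k, ((p.1 k - p.2 k) * star (p.1 k - p.2 k) / θ +
        star (p.1 k) * p.2 k / t)) := by
  rw [heatKernel, gaussianDensity, Complex.ofReal_mul, Complex.ofReal_exp, mul_assoc,
    ← Complex.exp_add, Finset.sum_add_distrib, ← Finset.sum_div, ← Finset.sum_div]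
  congr 3
  have : ∀ z : ℂ, z * star z = ((‖z‖ ^ 2 : ℝ) : ℂ) := fun z => by
    rw [Complex.star_def, Complex.mul_conj, Complex.normSq_eq_norm_sq]
  simp only [this, Pi.sub_apply]
  push_cast
  ring

theorem continuous_heatKernel (n : ℕ) (t θ : ℝ) : Continuous (heatKernel n t θ) := by
  rw [funext (heatKernel_eq n t θ)]
  fun_prop

theorem hasLineDerivAt_heatKernel (n : ℕ) (t θ : ℝ) (p v : (Fin n → ℂ) × (Fin n → ℂ)) :
    HasLineDerivAt ℝ (heatKernel n t θ)
      (-(∑ k, (((v.1 k - v.2 k) * star (p.1 k - p.2 k) + (p.1 k - p.2 k) * star (v.1 k - v.2 k)) / θ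
        + (star (v.1 k) * p.2 k + star (p.1 k) * v.2 k) / t)) * heatKernel n t θ p) p v := by
  have hl : ∀ a b : ℂ, HasDerivAt (fun y : ℝ => a + y * b) b 0 := fun a b => by
    simpa using ((Complex.ofRealCLM.hasDerivAt (x := (0 : ℝ))).mul_const b).const_add a
  have hs : ∀ k, HasDerivAt (fun y : ℝ =>
      (((p.1 k - p.2 k) + y * (v.1 k - v.2 k)) * star ((p.1 k - p.2 k) + y * (v.1 k - v.2 k)) / θ +
        star (p.1 k + y * v.1 k) * (p.2 k + y * v.2 k) / t : ℂ))
      (((v.1 k - v.2 k) * star (p.1 k - p.2 k) + (p.1 k - p.2 k) * star (v.1 k - v.2 k)) / θ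
        + (star (v.1 k) * p.2 k + star (p.1 k) * v.2 k) / t) 0 := by
    intro k
    have h1 := hl (p.1 k - p.2 k) (v.1 k - v.2 k)
    have h2 := hl (p.1 k) (v.1 k)
    have h3 := hl (p.2 k) (v.2 k)
    have := ((h1.mul h1.star).div_const (θ : ℂ)).add ((h2.star.mul h3).div_const (t : ℂ))
    simp only [zero_mul, Complex.ofReal_zero, add_zero] at this ⊢
    exact this
  have := ((HasDerivAt.fun_sum fun k (_ : k ∈ Finset.univ) => hs k).neg.cexp).const_mul
    ((((Real.pi * θ) ^ n)⁻¹ : ℝ) : ℂ)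
  refine (this.congr_deriv ?_).congr_of_eventuallyEq (Eventually.of_forall fun y => ?_)
  rotate_left
  · dsimp only
    rw [heatKernel_eq]
    simp only [Prod.fst_add, Prod.snd_add, Prod.smul_fst, Prod.smul_snd, Pi.add_apply,
      Pi.smul_apply, Complex.real_smul, Pi.neg_apply]
    congr 3
    refine Finset.sum_congr rfl fun k _ => ?_
    congr 1
    ring_nf
  · rw [heatKernel_eq]
    simp only [Pi.neg_apply, Complex.ofReal_zero, zero_mul, add_zero]
    ring

theorem hasDerivAt_heatKernel (n : ℕ) (t : ℝ) {θ : ℝ} (hθ : 0 < θ)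
    (p : (Fin n → ℂ) × (Fin n → ℂ)) :
    HasDerivAt (fun θ => heatKernel n t θ p)
      (-(∑ k, (1 - (p.1 k - p.2 k) * star (p.1 k - p.2 k) / θ) / θ) * heatKernel n t θ p) θ := by
  have hE : HasDerivAt (fun y : ℝ => -∑ k, ((p.1 k - p.2 k) * star (p.1 k - p.2 k) / (y : ℂ) +
        star (p.1 k) * p.2 k / t))
      (∑ k, ((p.1 k - p.2 k) * star (p.1 k - p.2 k) / (θ : ℂ) ^ 2)) θ := by
    rw [← neg_neg (∑ k, _), ← Finset.sum_neg_distrib]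
    refine HasDerivAt.neg (HasDerivAt.fun_sum fun k _ => ?_)
    have h1 : HasDerivAt (fun y : ℝ => ((y : ℂ))⁻¹) (-1 / (θ : ℂ) ^ 2) θ := by
      have := (Complex.ofRealCLM.hasDerivAt (x := θ)).fun_inv (by simpa using hθ.ne')
      simpa using this
    have := (h1.const_mul ((p.1 k - p.2 k) * star (p.1 k - p.2 k))).add_const
      (star (p.1 k) * p.2 k / t)
    simp only [div_eq_mul_inv] at this ⊢
    convert this using 1
    ring
  have hc : HasDerivAt (fun y : ℝ => ((((Real.pi * y) ^ n)⁻¹ : ℝ) : ℂ))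
      (-(n / θ) * ((((Real.pi * θ) ^ n)⁻¹ : ℝ) : ℂ)) θ := by
    have h0 : (Real.pi * θ) ≠ 0 := by positivity
    have h1 : HasDerivAt (fun y : ℝ => (Real.pi * y)) Real.pi θ := by
      simpa using (hasDerivAt_id θ).const_mul Real.pi
    have h2 := ((h1.fun_pow n).fun_inv (pow_ne_zero n h0)).ofReal_comp
    convert h2 using 1
    norm_cast
    -- Differentiating the power produces the exponent `n - 1`, so `n = 0` is separate.
    rcases n with _ | m
    · simp
    · have := Real.pi_pos
      simp only [Nat.add_sub_cancel]
      rw [pow_succ]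
      push_cast
      field_simp
  have := hc.mul hE.cexp
  have e : (fun y => heatKernel n t y p) = (fun y : ℝ => ((((Real.pi * y) ^ n)⁻¹ : ℝ) : ℂ)) *
      fun y : ℝ => Complex.exp (-∑ k, ((p.1 k - p.2 k) * star (p.1 k - p.2 k) / (y : ℂ) +
        star (p.1 k) * p.2 k / t)) := by
    funext y
    exact heatKernel_eq n t y p
  rw [e]
  refine this.congr_deriv ?_
  rw [heatKernel_eq]
  have : ∑ k, (1 - (p.1 k - p.2 k) * star (p.1 k - p.2 k) / (θ : ℂ)) / θ =
      n / θ - ∑ k, (p.1 k - p.2 k) * star (p.1 k - p.2 k) / (θ : ℂ) ^ 2 := by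
    simp only [sub_div, Finset.sum_sub_distrib]
    simp [pow_two, div_eq_mul_inv, mul_assoc]
  rw [this]
  ring

theorem hasCompactSupport_mul_prod {n : ℕ} {a b : (Fin n → ℂ) → ℂ} (ha : HasCompactSupport a)
    (hb : HasCompactSupport b) :
    HasCompactSupport fun p : (Fin n → ℂ) × (Fin n → ℂ) => a p.2 * b p.1 := by
  refine HasCompactSupport.intro (IsCompact.prod hb ha) fun p hp => ?_
  rw [Set.mem_prod, not_and_or] at hp
  rcases hp with h | h
  · rw [image_eq_zero_of_notMem_tsupport h, mul_zero]
  · rw [image_eq_zero_of_notMem_tsupport h, zero_mul]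

theorem continuous_dzbar {n : ℕ} {φ : (Fin n → ℂ) → ℂ} (hφ : ContDiff ℝ 1 φ) (j : Fin n) :
    Continuous (dzbar j φ) := by
  have h : ∀ v, Continuous fun z => fderiv ℝ φ z v := fun v =>
    (hφ.continuous_fderiv one_ne_zero).clm_apply continuous_const
  exact ((h _).add (continuous_const.mul (h _))).div_const _

theorem hasCompactSupport_dzbar {n : ℕ} {φ : (Fin n → ℂ) → ℂ} (hφ : HasCompactSupport φ)
    (j : Fin n) : HasCompactSupport (dzbar j φ) := by
  refine (hφ.fderiv ℝ).comp_left (g := fun L : (Fin n → ℂ) →L[ℝ] ℂ =>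
    (L (Pi.single j 1) + Complex.I * L (Pi.single j Complex.I)) / 2) ?_
  simp

theorem hasLineDerivAt_mul_snd {n : ℕ} {φ : (Fin n → ℂ) → ℂ} (χ : (Fin n → ℂ) → ℂ)
    (hφ : ContDiff ℝ 1 φ) (v : Fin n → ℂ) (p : (Fin n → ℂ) × (Fin n → ℂ)) :
    HasLineDerivAt ℝ (fun p : (Fin n → ℂ) × (Fin n → ℂ) => φ p.2 * χ p.1)
      (fderiv ℝ φ p.2 v * χ p.1) p (0, v) := by
  have := ((hφ.differentiable one_ne_zero p.2).hasFDerivAt.hasLineDerivAt v)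
  rw [HasLineDerivAt] at this ⊢
  simpa using this.mul_const (χ p.1)

theorem hasLineDerivAt_mul_star_fst {n : ℕ} {ψ : (Fin n → ℂ) → ℂ} (χ : (Fin n → ℂ) → ℂ)
    (hψ : ContDiff ℝ 1 ψ) (v : Fin n → ℂ) (p : (Fin n → ℂ) × (Fin n → ℂ)) :
    HasLineDerivAt ℝ (fun p : (Fin n → ℂ) × (Fin n → ℂ) => χ p.2 * star (ψ p.1))
      (χ p.2 * star (fderiv ℝ ψ p.1 v)) p (v, 0) := by
  have := ((hψ.differentiable one_ne_zero p.1).hasFDerivAt.hasLineDerivAt v)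
  rw [HasLineDerivAt] at this ⊢
  have h := this.star.const_mul (χ p.2)
  simpa using h

/-- The factor `exp(-z̄·w/t)` is holomorphic in `w`, so `∂̄` in `w` sees only the Gaussian
`exp(-|z-w|²/θ)` and brings down `(z_j - w_j)/θ`. -/
theorem integral_heatKernel_mul_dzbar {n : ℕ} (t θ : ℝ) {φ χ : (Fin n → ℂ) → ℂ}
    (hφ : ContDiff ℝ 1 φ) (cφ : HasCompactSupport φ) (hχ : Continuous χ)
    (cχ : HasCompactSupport χ) (j : Fin n) :
    ∫ p, heatKernel n t θ p * (dzbar j φ p.2 * χ p.1) =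
      -∫ p, (p.1 j - p.2 j) / θ * heatKernel n t θ p * (φ p.2 * χ p.1) := by
  have hκ := continuous_heatKernel n t θ
  have hfd : ∀ v, Continuous fun p : (Fin n → ℂ) × (Fin n → ℂ) => fderiv ℝ φ p.2 v * χ p.1 :=
    fun v => (((hφ.continuous_fderiv one_ne_zero).clm_apply continuous_const).comp
      continuous_snd).mul (hχ.comp continuous_fst)
  have hcs : ∀ v, HasCompactSupport
      fun p : (Fin n → ℂ) × (Fin n → ℂ) => fderiv ℝ φ p.2 v * χ p.1 :=
    fun v => hasCompactSupport_mul_prod (a := fun z => fderiv ℝ φ z v) (cφ.fderiv_apply ℝ v) cχ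
  have h := integral_mul_lineDeriv_add (μ := (volume : Measure ((Fin n → ℂ) × (Fin n → ℂ))))
    Complex.I hκ
    (G := fun p : (Fin n → ℂ) × (Fin n → ℂ) => φ p.2 * χ p.1)
    (by fun_prop) (by fun_prop) ((hφ.continuous.comp continuous_snd).mul (hχ.comp continuous_fst))
    (hfd (Pi.single j 1)) (hfd (Pi.single j Complex.I))
    (hasCompactSupport_mul_prod cφ cχ) (hcs (Pi.single j 1)) (hcs (Pi.single j Complex.I))
    (fun x => hasLineDerivAt_heatKernel n t θ x (0, Pi.single j 1))
    (fun x => hasLineDerivAt_heatKernel n t θ x (0, Pi.single j Complex.I))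
    (hasLineDerivAt_mul_snd χ hφ _) (hasLineDerivAt_mul_snd χ hφ _)
  have e1 : ∀ p : (Fin n → ℂ) × (Fin n → ℂ), heatKernel n t θ p * (dzbar j φ p.2 * χ p.1) =
      2⁻¹ * (heatKernel n t θ p * (fderiv ℝ φ p.2 (Pi.single j 1) * χ p.1 +
        Complex.I * (fderiv ℝ φ p.2 (Pi.single j Complex.I) * χ p.1))) := by
    intro p
    rw [dzbar]
    ring
  simp only [e1]
  rw [integral_const_mul, h, mul_neg, ← integral_const_mul]
  congr 2
  funext p
  have hs : ∀ c : ℂ, ∑ k, ((((0 : Fin n → ℂ) k - (Pi.single j c : Fin n → ℂ) k) *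
      star (p.1 k - p.2 k) + (p.1 k - p.2 k) * star ((0 : Fin n → ℂ) k -
      (Pi.single j c : Fin n → ℂ) k)) / (θ : ℂ) + (star ((0 : Fin n → ℂ) k) * p.2 k +
      star (p.1 k) * (Pi.single j c : Fin n → ℂ) k) / (t : ℂ)) =
      (-c * star (p.1 j - p.2 j) - (p.1 j - p.2 j) * star c) / θ + star (p.1 j) * c / t := by
    intro c
    rw [Finset.sum_eq_single j]
    · simp; ring
    · intro k _ hk
      simp [hk]
    · simp
  simp only [hs]
  have hI : star Complex.I = -Complex.I := by simp
  simp only [hI, star_one]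
  -- The coefficient gathers the terms that carry `I²`, all from the direction `I`. Once `I² = -1`,
  -- the conjugated terms cancel against those of the direction `1`, and the terms in `p.1 j - p.2
  -- j` add up.
  linear_combination (2⁻¹ * (star (p.1 j - p.2 j) / θ - (p.1 j - p.2 j) / θ
    - star (p.1 j) / t) * heatKernel n t θ p * (φ p.2 * χ p.1)) * Complex.I_sq

/-- The conjugate of `∂̄ψ` is `∂` applied to the conjugate of `ψ`, and `exp(-z̄·w/t)` is
antiholomorphic in `z`. Hence `∂` in `z` acts only on `(z_j - w_j)` times the Gaussian, where the
product rule gives `1 - |z_j - w_j|²/θ`. -/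
theorem integral_heatKernel_mul_star_dzbar {n : ℕ} (t θ : ℝ) {χ ψ : (Fin n → ℂ) → ℂ}
    (hψ : ContDiff ℝ 1 ψ) (cψ : HasCompactSupport ψ) (hχ : Continuous χ)
    (cχ : HasCompactSupport χ) (j : Fin n) :
    ∫ p, (p.1 j - p.2 j) * heatKernel n t θ p * (χ p.2 * star (dzbar j ψ p.1)) =
      -∫ p, (1 - (p.1 j - p.2 j) * star (p.1 j - p.2 j) / θ) * heatKernel n t θ p *
        (χ p.2 * star (ψ p.1)) := by
  have hκ := continuous_heatKernel n t θ
  have hfd : ∀ v, Continuous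
      fun p : (Fin n → ℂ) × (Fin n → ℂ) => χ p.2 * star (fderiv ℝ ψ p.1 v) :=
    fun v => (hχ.comp continuous_snd).mul (((hψ.continuous_fderiv one_ne_zero).clm_apply
      continuous_const).comp continuous_fst).star
  have cst : ∀ {a : (Fin n → ℂ) → ℂ}, HasCompactSupport a → HasCompactSupport fun z => star (a z) :=
    fun h => h.comp_left (g := star) (star_zero _)
  have hcs : ∀ v, HasCompactSupport
      fun p : (Fin n → ℂ) × (Fin n → ℂ) => χ p.2 * star (fderiv ℝ ψ p.1 v) :=
    fun v => hasCompactSupport_mul_prod (b := fun z => star (fderiv ℝ ψ z v)) cχ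
      (cst (cψ.fderiv_apply ℝ v))
  have hK : ∀ c : ℂ, ∀ p : (Fin n → ℂ) × (Fin n → ℂ),
      HasLineDerivAt ℝ (fun p => (p.1 j - p.2 j) * heatKernel n t θ p)
      ((c - (p.1 j - p.2 j) * ((c * star (p.1 j - p.2 j) + (p.1 j - p.2 j) * star c) / θ +
        star c * p.2 j / t)) * heatKernel n t θ p) p (Pi.single j c, 0) := by
    intro c p
    have h1 := hasLineDerivAt_heatKernel n t θ p (Pi.single j c, 0)
    have h2 : HasDerivAt (fun y : ℝ => p.1 j - p.2 j + y * c) c 0 := by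
      simpa using ((Complex.ofRealCLM.hasDerivAt (x := (0 : ℝ))).mul_const c).const_add
        (p.1 j - p.2 j)
    rw [HasLineDerivAt] at h1 ⊢
    refine ((h2.mul h1).congr_deriv ?_).congr_of_eventuallyEq (Eventually.of_forall fun y => ?_)
    · rw [Finset.sum_eq_single j]
      · simp; ring
      · intro k _ hk
        simp [hk]
      · simp
    · simp
      left
      ring
  have h := integral_mul_lineDeriv_add (μ := (volume : Measure ((Fin n → ℂ) × (Fin n → ℂ))))
    (-Complex.I)
    (K := fun p => (p.1 j - p.2 j) * heatKernel n t θ p)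
    (G := fun p : (Fin n → ℂ) × (Fin n → ℂ) => χ p.2 * star (ψ p.1)) (by fun_prop)
    (by fun_prop) (by fun_prop)
    ((hχ.comp continuous_snd).mul (hψ.continuous.comp continuous_fst).star)
    (hfd (Pi.single j 1)) (hfd (Pi.single j Complex.I))
    (hasCompactSupport_mul_prod (b := fun z => star (ψ z)) cχ (cst cψ))
    (hcs (Pi.single j 1)) (hcs (Pi.single j Complex.I)) (hK 1) (hK Complex.I)
    (hasLineDerivAt_mul_star_fst χ hψ _) (hasLineDerivAt_mul_star_fst χ hψ _)
  have e1 : ∀ p : (Fin n → ℂ) × (Fin n → ℂ),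
      (p.1 j - p.2 j) * heatKernel n t θ p * (χ p.2 * star (dzbar j ψ p.1)) =
      2⁻¹ * ((p.1 j - p.2 j) * heatKernel n t θ p *
        (χ p.2 * star (fderiv ℝ ψ p.1 (Pi.single j 1)) +
        -Complex.I * (χ p.2 * star (fderiv ℝ ψ p.1 (Pi.single j Complex.I))))) := by
    intro p
    simp only [dzbar, Complex.star_def, map_div₀, map_add, map_mul, Complex.conj_I, map_ofNat]
    ring
  simp only [e1]
  rw [integral_const_mul, h, mul_neg, ← integral_const_mul]
  congr 2
  funext p
  have hI : star Complex.I = -Complex.I := by simp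
  simp only [hI, star_one]
  linear_combination (-2⁻¹ * (1 - (p.1 j - p.2 j) * star (p.1 j - p.2 j) / θ +
    (p.1 j - p.2 j) * ((p.1 j - p.2 j) / θ + p.2 j / t))
    * heatKernel n t θ p * (χ p.2 * star (ψ p.1))) * Complex.I_sq

/-- Integrating by parts first in `w` and then in `z` leaves the weight that, summed over `j`, is
minus the logarithmic derivative in `θ` of the kernel. The prefactor `(z_j - w_j)/θ` of the first
step is the one that the second step differentiates. -/
theorem heatForm_dzbar {n : ℕ} (t θ : ℝ) {φ ψ : (Fin n → ℂ) → ℂ}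
    (hφ : ContDiff ℝ 1 φ) (cφ : HasCompactSupport φ) (hψ : ContDiff ℝ 1 ψ)
    (cψ : HasCompactSupport ψ) (j : Fin n) :
    heatForm n t θ (dzbar j φ) (dzbar j ψ) = ((((Real.pi * t) ^ n)⁻¹ : ℝ) : ℂ) *
      ∫ p, (1 - (p.1 j - p.2 j) * star (p.1 j - p.2 j) / θ) / θ * heatKernel n t θ p *
        (φ p.2 * star (ψ p.1)) := by
  have h1 := integral_heatKernel_mul_dzbar t θ hφ cφ (continuous_dzbar hψ j).star
    ((hasCompactSupport_dzbar cψ j).comp_left (g := star) (star_zero _)) j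
  have h2 := integral_heatKernel_mul_star_dzbar t θ hψ cψ hφ.continuous cφ j
  rw [heatForm]
  congr 1
  refine h1.trans ?_
  have e1 : ∀ p : (Fin n → ℂ) × (Fin n → ℂ),
      (p.1 j - p.2 j) / (θ : ℂ) * heatKernel n t θ p * (φ p.2 * star (dzbar j ψ p.1)) =
      (θ : ℂ)⁻¹ * ((p.1 j - p.2 j) * heatKernel n t θ p * (φ p.2 * star (dzbar j ψ p.1))) :=
    fun p => by ring
  have e2 : ∀ p : (Fin n → ℂ) × (Fin n → ℂ),
      (1 - (p.1 j - p.2 j) * star (p.1 j - p.2 j) / (θ : ℂ)) / θ * heatKernel n t θ p *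
        (φ p.2 * star (ψ p.1)) = (θ : ℂ)⁻¹ * ((1 - (p.1 j - p.2 j) * star (p.1 j - p.2 j) / (θ : ℂ))
        * heatKernel n t θ p * (φ p.2 * star (ψ p.1))) := fun p => by ring
  simp only [e1, e2]
  rw [integral_const_mul, integral_const_mul, h2]
  ring

/-- Differentiation under the integral sign, followed by `heatForm_dzbar` read from right to left.
-/
theorem hasDerivAt_heatForm {n : ℕ} (t : ℝ) {θ : ℝ} (hθ : 0 < θ) {φ ψ : (Fin n → ℂ) → ℂ}
    (hφ : ContDiff ℝ 1 φ) (cφ : HasCompactSupport φ) (hψ : ContDiff ℝ 1 ψ)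
    (cψ : HasCompactSupport ψ) :
    HasDerivAt (fun θ => heatForm n t θ φ ψ)
      (-∑ j, heatForm n t θ (dzbar j φ) (dzbar j ψ)) θ := by
  set G : (Fin n → ℂ) × (Fin n → ℂ) → ℂ := fun p => φ p.2 * star (ψ p.1) with hG
  have Gc : Continuous G :=
    (hφ.continuous.comp continuous_snd).mul (hψ.continuous.comp continuous_fst).star
  have Gs : HasCompactSupport G := 
    hasCompactSupport_mul_prod (b := fun z => star (ψ z)) cφ
      (cψ.comp_left (g := star) (star_zero _))
  have int : ∀ {A : (Fin n → ℂ) × (Fin n → ℂ) → ℂ}, Continuous A →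
      Integrable fun p => A p * G p := fun hA =>
    (hA.mul Gc).integrable_of_hasCompactSupport Gs.mul_left
  let D : ℝ → (Fin n → ℂ) × (Fin n → ℂ) → ℂ := fun θ p =>
    -(∑ k, (1 - (p.1 k - p.2 k) * star (p.1 k - p.2 k) / θ) / θ) * heatKernel n t θ p
  -- The interval `[θ/2, 2θ]` stays away from the singularity at `0`, so compactness yields the
  -- dominating constant `M`.
  have hD : ContinuousOn (Function.uncurry D) (Set.Icc (θ / 2) (2 * θ) ×ˢ tsupport G) := by
    simp only [Function.uncurry_def, D, heatKernel_eq]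
    have h0 : ∀ x ∈ Set.Icc (θ / 2) (2 * θ) ×ˢ tsupport G, (x.1 : ℂ) ≠ 0 := fun x hx => by
      have := hx.1.1
      exact_mod_cast (by linarith : (0 : ℝ) < x.1).ne'
    have h1 : ∀ x ∈ Set.Icc (θ / 2) (2 * θ) ×ˢ tsupport G, (Real.pi * x.1) ^ n ≠ 0 := fun x hx => by
      have := hx.1.1
      have : 0 < x.1 := by linarith
      positivity
    fun_prop (disch := assumption)
  obtain ⟨M, hM⟩ := (isCompact_Icc.prod Gs).exists_bound_of_continuousOn hD
  have hDθ : Continuous (D θ) := by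
    have := continuous_heatKernel n t θ
    simp only [D]
    fun_prop
  have key := hasDerivAt_integral_of_dominated_loc_of_deriv_le
    (μ := (volume : Measure ((Fin n → ℂ) × (Fin n → ℂ)))) (𝕜 := ℝ)
    (F := fun θ p => heatKernel n t θ p * G p) (F' := fun θ p => D θ p * G p) (x₀ := θ)
    (s := Set.Ioo (θ / 2) (2 * θ)) (bound := fun p => M * ‖G p‖)
    (Ioo_mem_nhds (by linarith) (by linarith))
    (Eventually.of_forall fun x => (int (continuous_heatKernel n t x)).aestronglyMeasurable)
    (int (continuous_heatKernel n t θ)) (int hDθ).aestronglyMeasurable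
    (ae_of_all _ fun p x hx => ?_)
    ((Gc.integrable_of_hasCompactSupport Gs).norm.const_mul M)
    (ae_of_all _ fun p x hx => ?_)
  · have h := key.2.const_mul ((((Real.pi * t) ^ n)⁻¹ : ℝ) : ℂ)
    refine h.congr_deriv ?_
    simp only [heatForm_dzbar t θ hφ cφ hψ cψ]
    rw [← Finset.mul_sum, ← mul_neg, ← integral_finsetSum]
    · rw [← integral_neg]
      congr 2
      funext p
      simp only [D, hG, neg_mul, Finset.sum_mul]
    · intro j _
      refine int (A := fun p => (1 - (p.1 j - p.2 j) * star (p.1 j - p.2 j) / (θ : ℂ)) / θ *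
        heatKernel n t θ p) ?_
      have := continuous_heatKernel n t θ
      fun_prop
  · by_cases hp : p ∈ tsupport G
    · rw [norm_mul]
      exact mul_le_mul_of_nonneg_right (hM (x, p) ⟨Set.Ioo_subset_Icc_self hx, hp⟩) (norm_nonneg _)
    · simp [image_eq_zero_of_notMem_tsupport hp]
  · have hx0 : 0 < x := by linarith [hx.1]
    exact (hasDerivAt_heatKernel n t hx0 p).mul_const (G p)

theorem integral_comp_add_sqrt_smul {n : ℕ} {θ : ℝ} (hθ : 0 < θ) (f : (Fin n → ℂ) → ℂ)
    (z : Fin n → ℂ) : ∫ w, f w = θ ^ n * ∫ h, f (z + √θ • h) := by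
  have h1 := Measure.integral_comp_smul (volume : Measure (Fin n → ℂ)) (fun h => f (z + h)) √θ
  rw [integral_add_left_eq_self] at h1
  -- The real dimension is `2n`, so the Jacobian is `√θ^(2n) = θ^n`.
  have h2 : √θ ^ Module.finrank ℝ (Fin n → ℂ) = θ ^ n := by
    rw [Module.finrank_pi_fintype]
    simp [pow_mul', Real.sq_sqrt hθ.le]
  rw [h1, h2, abs_of_pos (by positivity), Complex.real_smul, ← mul_assoc]
  have : (θ : ℂ) ^ n ≠ 0 := pow_ne_zero _ (by exact_mod_cast hθ.ne')
  push_cast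
  rw [mul_inv_cancel₀ this, one_mul]

theorem gaussianDensity_sqrt_smul {n : ℕ} {θ : ℝ} (hθ : 0 < θ) (h : Fin n → ℂ) :
    θ ^ n * gaussianDensity n θ (-(√θ • h)) = gaussianDensity n 1 h := by
  rw [gaussianDensity_neg]
  simp only [gaussianDensity, Pi.smul_apply, norm_smul, mul_pow, Real.norm_eq_abs, sq_abs,
    Real.sq_sqrt hθ.le, ← Finset.mul_sum, mul_one, mul_inv]
  rw [← mul_neg, mul_div_cancel_left₀ _ hθ.ne', div_one]
  have : θ ^ n ≠ 0 := by positivity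
  field_simp

/-- The domination for the limit `θ → 0`. In each coordinate the exponent is at most `(R/t)‖h_k‖ ≤
R²/(2t²) + ‖h_k‖²/2`; the quadratic term halves the Gaussian exponent, turning the parameter `1`
into `2`. -/
theorem norm_exp_mul_gaussianDensity_le {n : ℕ} {t R θ : ℝ} (ht : 0 < t) (hθ : θ ≤ 1)
    {z : Fin n → ℂ} (hz : ‖z‖ ≤ R) (h : Fin n → ℂ) :
    ‖(gaussianDensity n 1 h : ℂ) *
      Complex.exp (-(∑ k, star (z k) * (z k + √θ * h k)) / t)‖ ≤
      Real.exp (n * (R ^ 2 / (2 * t ^ 2))) * 2 ^ n * gaussianDensity n 2 h := by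
  have hR : 0 ≤ R := (norm_nonneg z).trans hz
  have hs : √θ ≤ 1 := Real.sqrt_le_one.2 hθ
  have hre : (-(∑ k, star (z k) * (z k + √θ * h k)) / (t : ℂ)).re ≤
      n * (R ^ 2 / (2 * t ^ 2)) + (∑ k, ‖h k‖ ^ 2) / 2 := by
    rw [Complex.div_ofReal_re, Complex.neg_re, Complex.re_sum, ← Finset.sum_neg_distrib,
      Finset.sum_div, Finset.sum_div]
    have : (n : ℝ) * (R ^ 2 / (2 * t ^ 2)) = ∑ _k : Fin n, R ^ 2 / (2 * t ^ 2) := by simp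
    rw [this, ← Finset.sum_add_distrib]
    refine Finset.sum_le_sum fun k _ => ?_
    have e : -(star (z k) * (z k + √θ * h k)).re =
        -‖z k‖ ^ 2 - √θ * (star (z k) * h k).re := by
      rw [← Complex.normSq_eq_norm_sq, Complex.normSq_apply]
      simp
      ring
    have h1 : |(star (z k) * h k).re| ≤ R * ‖h k‖ := by
      refine (Complex.abs_re_le_norm _).trans ?_
      rw [norm_mul, norm_star]
      gcongr
      exact (norm_le_pi_norm z k).trans hz
    have h2 : -(√θ * (star (z k) * h k).re) ≤ R * ‖h k‖ := by
      rw [← mul_neg]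
      calc √θ * -(star (z k) * h k).re ≤ √θ * (R * ‖h k‖) := by
            gcongr
            exact (neg_le_abs _).trans h1
        _ ≤ 1 * (R * ‖h k‖) := by gcongr
        _ = _ := one_mul _
    rw [e, div_le_iff₀ ht]
    have h3 : (R ^ 2 / (2 * t ^ 2) + ‖h k‖ ^ 2 / 2) * t = (R ^ 2 / t ^ 2 + ‖h k‖ ^ 2) * t / 2 := by
      field_simp
    have h4 : 2 * (R / t * ‖h k‖) ≤ R ^ 2 / t ^ 2 + ‖h k‖ ^ 2 := by
      have := two_mul_le_add_sq (R / t) ‖h k‖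
      rw [div_pow] at this
      linarith
    have h5 : R * ‖h k‖ = 2 * (R / t * ‖h k‖) * t / 2 := by field_simp
    have h6 : 2 * (R / t * ‖h k‖) * t ≤ (R ^ 2 / t ^ 2 + ‖h k‖ ^ 2) * t := by gcongr
    rw [h3]
    nlinarith [sq_nonneg ‖z k‖]
  rw [norm_mul, Complex.norm_real, Real.norm_eq_abs, abs_of_pos (gaussianDensity_pos n one_pos h),
    Complex.norm_exp]
  have e2 : Real.exp (n * (R ^ 2 / (2 * t ^ 2))) * 2 ^ n * gaussianDensity n 2 h =
      gaussianDensity n 1 h * Real.exp (n * (R ^ 2 / (2 * t ^ 2)) + (∑ k, ‖h k‖ ^ 2) / 2) := by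
    simp only [gaussianDensity]
    rw [Real.exp_add, mul_pow, mul_pow]
    have : -(∑ k, ‖h k‖ ^ 2) / 2 = -(∑ k, ‖h k‖ ^ 2) / 1 + (∑ k, ‖h k‖ ^ 2) / 2 := by ring
    rw [this, Real.exp_add]
    field_simp
    simp
  rw [e2]
  have := gaussianDensity_pos n one_pos h
  gcongr

/-- The kernel is an approximate identity: the substitution `w = z + √θ h` freezes the Gaussian at
parameter `1`, and dominated convergence applies. On the diagonal, `exp(-z̄·z/t)` with the prefactor
is the density of `μ_t`. -/
theorem tendsto_heatForm {n : ℕ} {t : ℝ} (ht : 0 < t) {φ ψ : (Fin n → ℂ) → ℂ}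
    (hφ : Continuous φ) (cφ : HasCompactSupport φ) (hψ : Continuous ψ)
    (cψ : HasCompactSupport ψ) :
    Tendsto (fun θ => heatForm n t θ φ ψ) (𝓝[>] 0)
      (𝓝 (∫ z, φ z * star (ψ z) ∂(gaussian n t))) := by
  let J : ℝ → (Fin n → ℂ) × (Fin n → ℂ) → ℂ := fun θ p => (gaussianDensity n 1 p.2 : ℂ) *
    Complex.exp (-(∑ k, star (p.1 k) * (p.1 k + √θ * p.2 k)) / t) *
    (φ (p.1 + √θ • p.2) * star (ψ p.1))
  have Jc : ∀ θ, Continuous (J θ) := fun θ => by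
    have := continuous_gaussianDensity n 1
    simp only [J]
    fun_prop
  obtain ⟨M, hM⟩ := hφ.bounded_above_of_compact_support cφ
  obtain ⟨R, hR⟩ := cψ.exists_bound_of_continuousOn continuous_id.continuousOn
  set C := Real.exp (n * (R ^ 2 / (2 * t ^ 2))) * 2 ^ n * M
  have hbound : ∀ θ ≤ 1, ∀ p, ‖J θ p‖ ≤ C * (‖ψ p.1‖ * gaussianDensity n 2 p.2) := by
    intro θ hθ p
    by_cases hp : p.1 ∈ tsupport ψ
    · simp only [J]
      rw [norm_mul, norm_mul (φ _), norm_star]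
      have h1 := norm_exp_mul_gaussianDensity_le (n := n) ht hθ (hR _ hp) p.2
      calc _ ≤ Real.exp (n * (R ^ 2 / (2 * t ^ 2))) * 2 ^ n * gaussianDensity n 2 p.2 *
            (M * ‖ψ p.1‖) := by
            have h2 := gaussianDensity_pos n two_pos p.2
            have h3 := hM (p.1 + √θ • p.2)
            exact mul_le_mul h1 (by gcongr) (by positivity) (by positivity)
        _ = _ := by simp only [C]; ring
    · simp [J, image_eq_zero_of_notMem_tsupport hp]
  have hBint : Integrable fun p : (Fin n → ℂ) × (Fin n → ℂ) =>
      C * (‖ψ p.1‖ * gaussianDensity n 2 p.2) :=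
    ((hψ.integrable_of_hasCompactSupport cψ).norm.mul_prod
      (integrable_gaussianDensity n two_pos)).const_mul C
  have Jint : ∀ θ ≤ 1, Integrable (J θ) := fun θ hθ =>
    hBint.mono' (Jc θ).aestronglyMeasurable (ae_of_all _ (hbound θ hθ))
  have hform : ∀ θ, 0 < θ → θ ≤ 1 → heatForm n t θ φ ψ =
      ((((Real.pi * t) ^ n)⁻¹ : ℝ) : ℂ) * ∫ p, J θ p := by
    intro θ hθ hθ1
    have hint : Integrable fun p : (Fin n → ℂ) × (Fin n → ℂ) =>
        heatKernel n t θ p * (φ p.2 * star (ψ p.1)) :=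
      ((continuous_heatKernel n t θ).mul ((hφ.comp continuous_snd).mul
        (hψ.comp continuous_fst).star)).integrable_of_hasCompactSupport
        (hasCompactSupport_mul_prod (b := fun z => star (ψ z)) cφ
          (cψ.comp_left (g := star) (star_zero _))).mul_left
    rw [heatForm]
    congr 1
    rw [Measure.volume_eq_prod, integral_prod _ hint, integral_prod _ (Jint θ hθ1)]
    congr 1
    funext z
    rw [integral_comp_add_sqrt_smul hθ _ z, ← integral_const_mul]
    congr 1
    funext h
    simp only [J, heatKernel, sub_add_cancel_left]
    rw [← gaussianDensity_sqrt_smul hθ h]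
    simp only [Pi.add_apply, Pi.smul_apply, Complex.real_smul]
    push_cast
    ring
  have hlim : Tendsto (fun θ => ∫ p, J θ p) (𝓝[>] 0) (𝓝 (∫ p, J 0 p)) := by
    refine tendsto_integral_filter_of_dominated_convergence _
      (Eventually.of_forall fun θ => (Jc θ).aestronglyMeasurable) ?_ hBint
      (ae_of_all _ fun p => ?_)
    · filter_upwards [Ioc_mem_nhdsGT one_pos] with θ hθ
      exact ae_of_all _ (hbound θ hθ.2)
    · have : Continuous fun θ : ℝ => J θ p := by
        simp only [J]
        fun_prop
      exact (this.tendsto 0).mono_left nhdsWithin_le_nhds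
  have hJ0 : ((((Real.pi * t) ^ n)⁻¹ : ℝ) : ℂ) * ∫ p, J 0 p =
      ∫ z, φ z * star (ψ z) ∂(gaussian n t) := by
    have e : ∀ p, J 0 p = (Complex.exp (-(∑ k, star (p.1 k) * p.1 k) / t) *
        (φ p.1 * star (ψ p.1))) * (gaussianDensity n 1 p.2 : ℂ) := by
      intro p
      simp [J]
      ring
    simp only [e]
    rw [Measure.volume_eq_prod, integral_prod_mul
      (fun z => Complex.exp (-(∑ k, star (z k) * z k) / t) * (φ z * star (ψ z)))
      (fun z => (gaussianDensity n 1 z : ℂ)), integral_complex_ofReal,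
      integral_gaussianDensity n one_pos, Complex.ofReal_one, mul_one, ← integral_const_mul,
      integral_gaussian n ht]
    congr 1
    funext z
    have : ∀ a : ℂ, star a * a = ((‖a‖ ^ 2 : ℝ) : ℂ) := fun a => by
      rw [Complex.star_def, mul_comm, Complex.mul_conj, Complex.normSq_eq_norm_sq]
    simp only [this, gaussianDensity, Complex.real_smul]
    push_cast
    ring
  rw [← hJ0]
  refine (hlim.const_mul _).congr' ?_
  filter_upwards [Ioc_mem_nhdsGT one_pos] with θ hθ
  exact (hform θ hθ.1 hθ.2).symm

/-! ### Second order expansion -/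

/-- The mean value inequality on `[ε, s]`, letting `ε → 0`; only the one-sided limit at `0` is
available, since the forms degenerate there. -/
theorem norm_sub_le_of_hasDerivAt_of_tendsto {F F' : ℝ → ℂ} {L : ℂ} {t C : ℝ}
    (hF : ∀ θ ∈ Set.Ioc 0 t, HasDerivAt F (F' θ) θ) (hC : ∀ θ ∈ Set.Ioc 0 t, ‖F' θ‖ ≤ C)
    (hL : Tendsto F (𝓝[>] 0) (𝓝 L)) {s : ℝ} (hs : s ∈ Set.Ioc 0 t) : ‖F s - L‖ ≤ C * s := by
  have h1 : Tendsto (fun ε => ‖F s - F ε‖) (𝓝[>] 0) (𝓝 ‖F s - L‖) :=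
    (tendsto_const_nhds.sub hL).norm
  refine le_of_tendsto h1 ?_
  filter_upwards [Ioc_mem_nhdsGT hs.1] with ε hε
  have h2 := (convex_Ioc (0 : ℝ) t).norm_image_sub_le_of_norm_hasDerivWithin_le
    (fun θ hθ => (hF θ hθ).hasDerivWithinAt) hC ⟨hε.1, hε.2.trans hs.2⟩ hs
  refine h2.trans ?_
  have hC0 : 0 ≤ C := (norm_nonneg _).trans (hC s hs)
  gcongr
  rw [Real.norm_eq_abs, abs_of_nonneg (by linarith [hε.2])]
  linarith [hε.1]

theorem integrable_norm_sq_gaussian {n : ℕ} {t : ℝ} (ht : 0 < t) {φ : (Fin n → ℂ) → ℂ}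
    (hφ : Continuous φ) (cφ : HasCompactSupport φ) :
    Integrable (fun z => ‖φ z‖ ^ 2) (gaussian n t) := by
  have := isProbabilityMeasure_gaussian n ht
  refine Continuous.integrable_of_hasCompactSupport (by fun_prop) ?_
  exact cφ.comp_left (g := fun z : ℂ => ‖z‖ ^ 2) (by simp)

/-- The evolution equation used twice. The second derivative in `θ` is bounded by `M`, so the first
derivative differs from its limit at `0` by at most `M t`, and the form differs from its linear part
by at most `M t²`. -/
theorem norm_heatForm_sub_taylor_le {n : ℕ} {t : ℝ} (ht : 0 < t) {φ ψ : (Fin n → ℂ) → ℂ}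
    (hφ : ContDiff ℝ 1 φ) (cφ : HasCompactSupport φ) (hψ : ContDiff ℝ 1 ψ)
    (cψ : HasCompactSupport ψ) (hφ' : ∀ j, ContDiff ℝ 1 (dzbar j φ))
    (hψ' : ∀ j, ContDiff ℝ 1 (dzbar j ψ)) :
    ‖heatForm n t t φ ψ - ∫ z, φ z * star (ψ z) ∂(gaussian n t)
      + t * ∑ j, ∫ z, dzbar j φ z * star (dzbar j ψ z) ∂(gaussian n t)‖ ≤
    (∑ j, ∑ k, 2 ^ n / 2 * ((∫ z, ‖dzbar k (dzbar j φ) z‖ ^ 2 ∂(gaussian n t)) +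
      ∫ z, ‖dzbar k (dzbar j ψ) z‖ ^ 2 ∂(gaussian n t))) * t * t := by
  set M := ∑ j, ∑ k, 2 ^ n / 2 * ((∫ z, ‖dzbar k (dzbar j φ) z‖ ^ 2 ∂(gaussian n t)) +
      ∫ z, ‖dzbar k (dzbar j ψ) z‖ ^ 2 ∂(gaussian n t)) with hM
  set L := ∫ z, φ z * star (ψ z) ∂(gaussian n t)
  set L' := ∑ j, ∫ z, dzbar j φ z * star (dzbar j ψ z) ∂(gaussian n t)
  have c1 : ∀ j, HasCompactSupport (dzbar j φ) := hasCompactSupport_dzbar cφ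
  have c2 : ∀ j, HasCompactSupport (dzbar j ψ) := hasCompactSupport_dzbar cψ
  have d1 : ∀ θ ∈ Set.Ioc 0 t,
      HasDerivAt (fun θ => ∑ j, heatForm n t θ (dzbar j φ) (dzbar j ψ))
      (∑ j, -∑ k, heatForm n t θ (dzbar k (dzbar j φ)) (dzbar k (dzbar j ψ))) θ := fun θ hθ =>
    HasDerivAt.fun_sum fun j _ => hasDerivAt_heatForm t hθ.1 (hφ' j) (c1 j) (hψ' j) (c2 j)
  have b1 : ∀ θ ∈ Set.Ioc 0 t,
      ‖∑ j, -∑ k, heatForm n t θ (dzbar k (dzbar j φ)) (dzbar k (dzbar j ψ))‖ ≤ M := by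
    intro θ hθ
    refine norm_sum_le_of_le _ fun j _ => ?_
    rw [norm_neg]
    refine norm_sum_le_of_le _ fun k _ => ?_
    exact norm_heatForm_le n hθ.1 hθ.2
      (integrable_norm_sq_gaussian ht (continuous_dzbar (hφ' j) k)
        (hasCompactSupport_dzbar (c1 j) k))
      (integrable_norm_sq_gaussian ht (continuous_dzbar (hψ' j) k)
        (hasCompactSupport_dzbar (c2 j) k))
  have t1 : Tendsto (fun θ => ∑ j, heatForm n t θ (dzbar j φ) (dzbar j ψ)) (𝓝[>] 0) (𝓝 L') :=
    tendsto_finsetSum _ fun j _ => tendsto_heatForm ht (hφ' j).continuous (c1 j)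
      (hψ' j).continuous (c2 j)
  have e1 : ∀ θ ∈ Set.Ioc 0 t,
      ‖-∑ j, heatForm n t θ (dzbar j φ) (dzbar j ψ) + L'‖ ≤ M * t := by
    intro θ hθ
    rw [neg_add_eq_sub, norm_sub_rev]
    refine (norm_sub_le_of_hasDerivAt_of_tendsto d1 b1 t1 hθ).trans ?_
    have hM0 : 0 ≤ M := (norm_nonneg _).trans (b1 θ hθ)
    gcongr
    exact hθ.2
  -- Adding `θ * L'` subtracts the linear Taylor term, so the derivative becomes the small quantity
  -- of `e1`.
  have d0 : ∀ θ ∈ Set.Ioc 0 t, HasDerivAt (fun θ : ℝ => heatForm n t θ φ ψ + θ * L')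
      (-∑ j, heatForm n t θ (dzbar j φ) (dzbar j ψ) + L') θ := by
    intro θ hθ
    have h := (Complex.ofRealCLM.hasDerivAt (x := θ)).mul_const L'
    simp only [Complex.ofRealCLM_apply, Complex.ofReal_one, one_mul] at h
    exact (hasDerivAt_heatForm t hθ.1 hφ cφ hψ cψ).add h
  have t0 : Tendsto (fun θ : ℝ => heatForm n t θ φ ψ + θ * L') (𝓝[>] 0) (𝓝 L) := by
    have h1 := tendsto_heatForm ht hφ.continuous cφ hψ.continuous cψ
    have h2 : Tendsto (fun θ : ℝ => (θ : ℂ) * L') (𝓝[>] 0) (𝓝 0) := by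
      have : Continuous fun θ : ℝ => (θ : ℂ) * L' := by fun_prop
      simpa using (this.tendsto 0).mono_left nhdsWithin_le_nhds
    rw [← add_zero L]
    exact h1.add h2
  have := norm_sub_le_of_hasDerivAt_of_tendsto d0 e1 t0 ⟨ht, le_rfl⟩
  rwa [add_sub_right_comm] at this

/-! ### The reproducing kernel -/

/-- Completing the square: the exponential only translates the Gaussian, which puts the reproducing
kernels in `L²_t`. -/
theorem gaussianDensity_mul_norm_exp_sq {n : ℕ} {t : ℝ} (ht : 0 < t) (w z : Fin n → ℂ) :
    gaussianDensity n t z * ‖Complex.exp ((∑ k, z k * star (w k)) / t)‖ ^ 2 =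
      Real.exp ((∑ k, ‖w k‖ ^ 2) / t) * gaussianDensity n t (z - w) := by
  have e : ∑ k, ‖(z - w) k‖ ^ 2 =
      ∑ k, ‖z k‖ ^ 2 + ∑ k, ‖w k‖ ^ 2 - 2 * (∑ k, z k * star (w k)).re := by
    rw [Complex.re_sum, Finset.mul_sum, ← Finset.sum_add_distrib, ← Finset.sum_sub_distrib]
    refine Finset.sum_congr rfl fun k _ => ?_
    simp only [Pi.sub_apply, ← Complex.normSq_eq_norm_sq, Complex.normSq_apply]
    simp
    ring
  rw [Complex.norm_exp, Complex.div_ofReal_re, ← Real.exp_nat_mul, gaussianDensity,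
    gaussianDensity, e, mul_left_comm, mul_assoc, ← Real.exp_add, ← Real.exp_add]
  congr 2
  push_cast
  field_simp
  ring

theorem memLp_exp {n : ℕ} {t : ℝ} (ht : 0 < t) (w : Fin n → ℂ) :
    MemLp (fun z => Complex.exp ((∑ k, z k * star (w k)) / t)) 2 (gaussian n t) := by
  have hc : Continuous fun z : Fin n → ℂ => Complex.exp ((∑ k, z k * star (w k)) / t) := by
    fun_prop
  rw [memLp_two_iff_integrable_sq_norm hc.aestronglyMeasurable, integrable_gaussian_iff n ht]
  simp only [smul_eq_mul, gaussianDensity_mul_norm_exp_sq ht]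
  exact ((integrable_gaussianDensity n ht).comp_sub_right w).const_mul _

/-- The mean value property with respect to a Gaussian measure. -/
theorem integral_gaussian_entire {n : ℕ} {t : ℝ} (ht : 0 < t) {U : (Fin n → ℂ) → ℂ}
    (hU : Differentiable ℂ U) (hint : Integrable U (gaussian n t)) :
    ∫ z, U z ∂(gaussian n t) = U 0 := by
  have := isProbabilityMeasure_gaussian n ht
  have hmp : ∀ a : Circle, MeasurePreserving (fun w : Fin n → ℂ => (a : ℂ) • w) := fun a =>
    volume_preserving_pi (f := fun _ : Fin n => fun x : ℂ => (a : ℂ) * x)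
      (fun _ => (rotation a).measurePreserving)
  have hemb : ∀ a : Circle, MeasurableEmbedding (fun w : Fin n → ℂ => (a : ℂ) • w) := fun a =>
    (Homeomorph.smulOfNeZero (a : ℂ) (Circle.coe_ne_zero a)).measurableEmbedding
  have hrot : ∀ (a : Circle) (w : Fin n → ℂ),
      gaussianDensity n t ((a : ℂ) • w) = gaussianDensity n t w := fun a w => by
    simp only [gaussianDensity, Pi.smul_apply, norm_smul, Circle.norm_coe, one_mul]
  have h2 : ∀ a : Circle, ∫ w, U ((a : ℂ) • w) ∂(gaussian n t) = ∫ w, U w ∂(gaussian n t) := by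
    intro a
    rw [integral_gaussian n ht, integral_gaussian n ht,
      ← (hmp a).integral_comp (hemb a) (fun w => gaussianDensity n t w • U w)]
    simp only [hrot]
  have h2' : ∀ a : Circle,
      ∫ w, ‖U ((a : ℂ) • w)‖ ∂(gaussian n t) = ∫ w, ‖U w‖ ∂(gaussian n t) := by
    intro a
    rw [integral_gaussian n ht, integral_gaussian n ht,
      ← (hmp a).integral_comp (hemb a) (fun w => gaussianDensity n t w • ‖U w‖)]
    simp only [hrot]
  have h2i : ∀ a : Circle, Integrable (fun w => U ((a : ℂ) • w)) (gaussian n t) := by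
    intro a
    rw [integrable_gaussian_iff n ht] at hint ⊢
    have := (hmp a).integrable_comp_of_integrable hint
    refine this.congr (ae_of_all _ fun w => ?_)
    simp only [Function.comp_apply, hrot]
  have h3 : ∀ w, ∫ θ in (0 : ℝ)..2 * Real.pi, U ((Circle.exp θ : ℂ) • w)
      = (2 * Real.pi) • U 0 := by
    intro w
    have hd : Differentiable ℂ (fun l : ℂ => U (l • w)) := by fun_prop
    have := (hd.diffContOnCl (s := Metric.ball 0 |1|)).circleAverage
    rw [Real.circleAverage_def] at this
    simp only [zero_smul] at this
    rw [← this, smul_smul, mul_inv_cancel₀ Real.two_pi_pos.ne', one_smul]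
    simp [circleMap, Circle.coe_exp]
  have hUc := hU.continuous
  have hcont : Continuous (Function.uncurry fun (θ : ℝ) (w : Fin n → ℂ) =>
      U ((Circle.exp θ : ℂ) • w)) := by
    have : Continuous fun θ : ℝ => ((Circle.exp θ : Circle) : ℂ) := by fun_prop
    unfold Function.uncurry
    fun_prop
  have hI : Integrable (Function.uncurry fun (θ : ℝ) (w : Fin n → ℂ) =>
      U ((Circle.exp θ : ℂ) • w))
      ((volume.restrict (Set.uIoc 0 (2 * Real.pi))).prod (gaussian n t)) := by
    -- `U` has no compact support here. Integrability on the product follows because, by rotation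
    -- invariance, the `L¹` norm of each slice does not depend on `θ`.
    rw [integrable_prod_iff hcont.aestronglyMeasurable]
    refine ⟨ae_of_all _ fun θ => h2i (Circle.exp θ), ?_⟩
    simp only [Function.uncurry, h2']
    have : IsFiniteMeasure (volume.restrict (Set.uIoc 0 (2 * Real.pi))) := by
      rw [Set.uIoc_of_le Real.two_pi_pos.le]
      infer_instance
    exact integrable_const _
  have h4 := intervalIntegral_integral_swap hI
  simp only [h2, h3] at h4
  rw [intervalIntegral.integral_const, sub_zero, integral_const] at h4
  simp only [probReal_univ, one_smul] at h4
  exact smul_right_injective ℂ Real.two_pi_pos.ne' h4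

theorem gaussianDensity_add_mul_exp {n : ℕ} {t : ℝ} (w h : Fin n → ℂ) :
    (gaussianDensity n t (w + h) : ℂ) * Complex.exp ((∑ k, w k * star ((w + h) k)) / t) =
      gaussianDensity n t h * Complex.exp (-(∑ k, star (w k) * h k) / t) := by
  have hn : ∀ z : ℂ, ((‖z‖ : ℂ)) ^ 2 = z * star z := fun z => by
    rw [Complex.star_def, Complex.mul_conj, Complex.normSq_eq_norm_sq]
    push_cast
    rfl
  simp only [gaussianDensity, Complex.ofReal_mul, Complex.ofReal_exp, mul_assoc]
  rw [← Complex.exp_add, ← Complex.exp_add]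
  congr 2
  push_cast
  simp only [hn, ← add_div, ← Finset.sum_neg_distrib, ← Finset.sum_add_distrib]
  congr 1
  refine Finset.sum_congr rfl fun k _ => ?_
  simp only [Pi.add_apply, star_add]
  ring

/-- Translating by `w` turns the antiholomorphic exponential times the density into a centred
density times an entire exponential (`gaussianDensity_add_mul_exp`). The Gaussian mean value
property then evaluates at `h = 0`. -/
theorem integral_mul_exp_eq {n : ℕ} {t : ℝ} (ht : 0 < t) {F : (Fin n → ℂ) → ℂ}
    (hF : Differentiable ℂ F) (hL : MemLp F 2 (gaussian n t)) (w : Fin n → ℂ) :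
    ∫ z, F z * Complex.exp ((∑ k, w k * star (z k)) / t) ∂(gaussian n t) = F w := by
  have hint : Integrable (fun z => F z * Complex.exp ((∑ k, w k * star (z k)) / t))
      (gaussian n t) := by
    have h := hL.integrable_mul (memLp_exp ht w).star
    refine h.congr (ae_of_all _ fun z => ?_)
    simp only [Pi.mul_apply, Pi.star_apply]
    congr 1
    rw [Complex.star_def, ← Complex.exp_conj]
    simp [mul_comm]
  let U : (Fin n → ℂ) → ℂ := fun h => F (w + h) * Complex.exp (-(∑ k, star (w k) * h k) / t)
  have hU : Differentiable ℂ U := by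
    simp only [U]
    fun_prop
  have e : ∀ h, gaussianDensity n t (w + h) • (F (w + h) *
      Complex.exp ((∑ k, w k * star ((w + h) k)) / t)) = gaussianDensity n t h • U h := by
    intro h
    simp only [Complex.real_smul, U]
    rw [mul_left_comm, gaussianDensity_add_mul_exp, mul_left_comm]
  have hUi : Integrable U (gaussian n t) := by
    rw [integrable_gaussian_iff n ht] at hint ⊢
    refine (hint.comp_add_left w).congr (ae_of_all _ fun h => ?_)
    exact e h
  have hU0 : U 0 = F w := by simp [U]
  rw [← hU0, ← integral_gaussian_entire ht hU hUi, integral_gaussian n ht, integral_gaussian n ht,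
    ← integral_add_left_eq_self _ w]
  exact integral_congr_ae (ae_of_all _ e)

/-! ### Multiplication, projection and Toeplitz operators in terms of functions -/

theorem coeFn_mulOp (n : ℕ) (t : ℝ) {f : (Fin n → ℂ) → ℂ} (hf : IsSymbol f) (φ : L2 n t) :
    mulOp n t f hf φ =ᵐ[gaussian n t] fun z => f z * φ z := by
  have h := (ContinuousLinearMap.mul ℂ ℂ).coeFn_holder (r := 2)
    ((hf.memLp (gaussian n t)).toLp f) φ
  filter_upwards [h, (hf.memLp (gaussian n t)).coeFn_toLp] with z h1 h2
  rw [← h2]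
  exact h1

theorem inner_toeplitz (n : ℕ) (t : ℝ) {f : (Fin n → ℂ) → ℂ} (hf : IsSymbol f)
    (u v : fock n t) :
    inner ℂ v (toeplitz n t f hf u) = inner ℂ (v : L2 n t) (mulOp n t f hf (u : L2 n t)) := by
  simp only [toeplitz, ContinuousLinearMap.comp_apply, Submodule.subtypeL_apply]
  exact Submodule.inner_orthogonalProjectionOnto_eq_of_mem_left v _

theorem inner_mulOp (n : ℕ) (t : ℝ) {f : (Fin n → ℂ) → ℂ} (hf : IsSymbol f) (φ ψ : L2 n t) :
    inner ℂ ψ (mulOp n t f hf φ) = ∫ z, f z * φ z * star (ψ z) ∂(gaussian n t) := by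
  rw [L2.inner_def]
  refine integral_congr_ae ?_
  filter_upwards [coeFn_mulOp n t hf φ] with z hz
  rw [hz, RCLike.inner_apply]
  rfl

/-- The Bergman kernel formula for the orthogonal projection onto the Fock space. -/
theorem coeFn_orthogonalProjectionOnto_fock {n : ℕ} {t : ℝ} (ht : 0 < t) (φ : L2 n t) :
    (((fock n t).orthogonalProjectionOnto φ : fock n t) : L2 n t) =ᵐ[gaussian n t] fun w =>
      ∫ z, φ z * Complex.exp ((∑ k, w k * star (z k)) / t) ∂(gaussian n t) := by
  obtain ⟨F, hF, hae⟩ := ((fock n t).orthogonalProjectionOnto φ).2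
  have hFL : MemLp F 2 (gaussian n t) := (memLp_congr_ae hae).1 (Lp.memLp _)
  refine hae.trans (ae_of_all _ fun w => ?_)
  -- The reproducing kernel at `w`: pairing it with `φ` and with its projection gives the same
  -- number, and the latter is `F w`.
  let κ : fock n t := ⟨(memLp_exp ht w).toLp _,
    ⟨fun z => Complex.exp ((∑ k, z k * star (w k)) / t), by fun_prop, (memLp_exp ht w).coeFn_toLp⟩⟩
  have hκ : ∀ χ : L2 n t, inner ℂ (κ : L2 n t) χ =
      ∫ z, χ z * Complex.exp ((∑ k, w k * star (z k)) / t) ∂(gaussian n t) := by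
    intro χ
    rw [L2.inner_def]
    refine integral_congr_ae ?_
    filter_upwards [(memLp_exp ht w).coeFn_toLp] with z hz
    rw [RCLike.inner_apply]
    congr 1
    simp only [κ]
    rw [hz, ← Complex.exp_conj]
    simp [mul_comm]
  have h1 := Submodule.inner_orthogonalProjectionOnto_eq_of_mem_left κ φ
  rw [Submodule.coe_inner, hκ, hκ] at h1
  refine Eq.trans ?_ h1
  rw [← integral_mul_exp_eq ht hF hFL w]
  refine integral_congr_ae ?_
  filter_upwards [hae] with z hz
  exact congrArg (· * _) hz.symm

/-- At `θ = t` the exponents combine into the Bergman kernel `exp(z·w̄/t)` times the two Gaussian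
weights; this is why the interpolation ends at the projection. -/
theorem mul_heatKernel_self {n : ℕ} {t : ℝ} (z w : Fin n → ℂ) :
    ((((Real.pi * t) ^ n)⁻¹ : ℝ) : ℂ) * heatKernel n t t (z, w) =
      gaussianDensity n t z * (gaussianDensity n t w *
        Complex.exp ((∑ k, z k * star (w k)) / t)) := by
  have hn : ∀ z : ℂ, ((‖z‖ : ℂ)) ^ 2 = z * star z := fun z => by
    rw [Complex.star_def, Complex.mul_conj, Complex.normSq_eq_norm_sq]
    push_cast
    rfl
  have he : Complex.exp (-∑ k, ((z k - w k) * star (z k - w k) / (t : ℂ) +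
      star (z k) * w k / t)) = Complex.exp (((-∑ j, ‖z j‖ ^ 2) / t : ℝ)) *
      (Complex.exp (((-∑ j, ‖w j‖ ^ 2) / t : ℝ)) *
        Complex.exp ((∑ k, z k * star (w k)) / t)) := by
    rw [← Complex.exp_add, ← Complex.exp_add]
    congr 1
    push_cast
    simp only [hn, ← add_div, ← Finset.sum_neg_distrib, ← Finset.sum_add_distrib, Finset.sum_div]
    refine Finset.sum_congr rfl fun k _ => ?_
    simp only [star_sub]
    ring
  simp only [heatKernel_eq, gaussianDensity, Complex.ofReal_mul, Complex.ofReal_exp, he]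
  ring

theorem integral_bergman_eq_heatForm {n : ℕ} {t : ℝ} (ht : 0 < t) {φ ψ : (Fin n → ℂ) → ℂ}
    (hφ : Continuous φ) (cφ : HasCompactSupport φ) (hψ : Continuous ψ)
    (cψ : HasCompactSupport ψ) :
    ∫ w, (∫ z, φ z * Complex.exp ((∑ k, w k * star (z k)) / t) ∂(gaussian n t)) * star (ψ w)
      ∂(gaussian n t) = heatForm n t t φ ψ := by
  have hint : Integrable fun p : (Fin n → ℂ) × (Fin n → ℂ) =>
      heatKernel n t t p * (φ p.2 * star (ψ p.1)) :=
    ((continuous_heatKernel n t t).mul ((hφ.comp continuous_snd).mul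
      (hψ.comp continuous_fst).star)).integrable_of_hasCompactSupport
      (hasCompactSupport_mul_prod (b := fun z => star (ψ z)) cφ
        (cψ.comp_left (g := star) (star_zero _))).mul_left
  rw [heatForm, Measure.volume_eq_prod, integral_prod _ hint, ← integral_const_mul,
    integral_gaussian n ht]
  congr 1
  funext z
  rw [integral_gaussian n ht, ← integral_mul_const, ← integral_smul, ← integral_const_mul]
  congr 1
  funext w
  have := mul_heatKernel_self (t := t) z w
  simp only [Complex.real_smul]
  linear_combination (-(φ w * star (ψ z))) * this

/-! ### Products of Toeplitz operators with compactly supported symbols -/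

/-- An entire function equals its convolution with a rotation invariant kernel, and so inherits the
regularity of that kernel. -/
theorem contDiff_entire {n : ℕ} {U : (Fin n → ℂ) → ℂ} (hU : Differentiable ℂ U) :
    ContDiff ℝ 1 U := by
  obtain ⟨χ, hχ, hχc, hχr, hχi⟩ := exists_kernel n
  have h := hχc.contDiff_convolution_right (ContinuousLinearMap.mul ℝ ℂ) (μ := volume)
    (hU.continuous.locallyIntegrable) hχ
  have e : U ⋆[ContinuousLinearMap.mul ℝ ℂ] χ = U := by
    funext z
    exact convolution_entire hχ.continuous hχc hχr hχi hU z
  rwa [e] at h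

/-- Complex linearity of the derivative of `U` kills `∂̄U`. This is why no derivative of the Fock
space vectors enters the estimates. -/
theorem dzbar_mul_entire {n : ℕ} {g U : (Fin n → ℂ) → ℂ} (hg : Differentiable ℝ g)
    (hU : Differentiable ℂ U) (j : Fin n) :
    dzbar j (fun z => g z * U z) = fun z => dzbar j g z * U z := by
  funext z
  have hU' : HasFDerivAt U ((fderiv ℂ U z).restrictScalars ℝ) z :=
    (hU z).hasFDerivAt.restrictScalars ℝ
  have h := ((hg z).hasFDerivAt.fun_mul hU').fderiv
  have hs : (fderiv ℂ U z) (Pi.single j Complex.I) =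
      Complex.I * (fderiv ℂ U z) (Pi.single j 1) := by
    rw [← smul_eq_mul, ← map_smul, ← Pi.single_smul, smul_eq_mul, mul_one]
  simp only [dzbar, h, add_apply, smul_apply,
    ContinuousLinearMap.coe_restrictScalars', hs, smul_eq_mul]
  linear_combination (2⁻¹ * g z * (fderiv ℂ U z) (Pi.single j 1)) * Complex.I_sq

theorem dzbar_star {n : ℕ} {f : (Fin n → ℂ) → ℂ} (hf : Differentiable ℝ f) (j : Fin n) :
    dzbar j (fun z => star (f z)) = fun z => star (dz j f z) := by
  funext z
  have h := (hf z).hasFDerivAt.star.fderiv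
  simp only [dzbar, dz, h]
  simp

theorem contDiff_dzbar {n : ℕ} {f : (Fin n → ℂ) → ℂ} (hf : ContDiff ℝ 2 f) (j : Fin n) :
    ContDiff ℝ 1 (dzbar j f) := by
  have h : ∀ v, ContDiff ℝ 1 fun z => fderiv ℝ f z v := fun v =>
    (hf.fderiv_right (m := 1) (by norm_num)).clm_apply contDiff_const
  exact ((h _).add (contDiff_const.mul (h _))).div_const _

theorem norm_sq_eq_integral {n : ℕ} {t : ℝ} (u : L2 n t) {U : (Fin n → ℂ) → ℂ}
    (hU : u =ᵐ[gaussian n t] U) : ‖u‖ ^ 2 = ∫ z, ‖U z‖ ^ 2 ∂(gaussian n t) := by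
  have h : ((‖u‖ ^ 2 : ℝ) : ℂ) = ((∫ z, ‖U z‖ ^ 2 ∂(gaussian n t) : ℝ) : ℂ) := by
    have h1 := inner_self_eq_norm_sq_to_K (𝕜 := ℂ) u
    rw [L2.inner_def] at h1
    push_cast
    refine h1.symm.trans ?_
    rw [← integral_complex_ofReal]
    refine integral_congr_ae ?_
    filter_upwards [hU] with z hz
    rw [hz, inner_self_eq_norm_sq_to_K]
    simp
  exact_mod_cast h

/-- The form bound is a sum of squares, not a product; testing against a multiple of `T u` of norm
`‖u‖` balances the two and costs the factor `2`. -/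
theorem norm_le_of_norm_inner_le {H : Type*} [NormedAddCommGroup H] [InnerProductSpace ℂ H]
    {T : H →L[ℂ] H} {C : ℝ} (hC : 0 ≤ C)
    (h : ∀ u v, ‖inner ℂ v (T u)‖ ≤ C * (‖u‖ ^ 2 + ‖v‖ ^ 2)) : ‖T‖ ≤ 2 * C := by
  refine T.opNorm_le_bound (by positivity) fun u => ?_
  by_cases hu : ‖T u‖ = 0
  · rw [hu]
    positivity
  by_cases hu' : ‖u‖ = 0
  · rw [norm_eq_zero] at hu'
    simp [hu']
  have h1 := h u (((‖u‖ / ‖T u‖ : ℝ) : ℂ) • T u)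
  have h2 : ‖((‖u‖ / ‖T u‖ : ℝ) : ℂ)‖ = ‖u‖ / ‖T u‖ := by
    rw [Complex.norm_real, Real.norm_eq_abs, abs_of_nonneg (by positivity)]
  have h3 : ‖inner ℂ (T u) (T u)‖ = ‖T u‖ ^ 2 := by
    rw [inner_self_eq_norm_sq_to_K]
    simp
  rw [inner_smul_left, norm_mul, RCLike.norm_conj, h3, norm_smul, h2] at h1
  have h4 : ‖u‖ / ‖T u‖ * ‖T u‖ = ‖u‖ := by field_simp
  rw [pow_two ‖T u‖, ← mul_assoc, h4] at h1
  have h5 : 0 < ‖u‖ := lt_of_le_of_ne (norm_nonneg _) (Ne.symm hu')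
  have h6 : ‖u‖ * ‖T u‖ ≤ ‖u‖ * (2 * C * ‖u‖) := h1.trans (le_of_eq (by ring))
  exact le_of_mul_le_mul_left h6 h5

/-- Moving `f` to the other side leaves `P(g u)` paired with `f̄ v`, which is the interpolating form
at its endpoint. -/
theorem inner_toeplitz_toeplitz {n : ℕ} {t : ℝ} (ht : 0 < t) {f g : (Fin n → ℂ) → ℂ}
    (hf : IsSymbol f) (hg : IsSymbol g) (hfc : Continuous f) (cf : HasCompactSupport f)
    (hgc : Continuous g) (cg : HasCompactSupport g) (u v : fock n t) {U V : (Fin n → ℂ) → ℂ}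
    (hU : Continuous U) (hV : Continuous V) (huU : (u : L2 n t) =ᵐ[gaussian n t] U)
    (hvV : (v : L2 n t) =ᵐ[gaussian n t] V) :
    inner ℂ v (toeplitz n t f hf (toeplitz n t g hg u)) =
      heatForm n t t (fun z => g z * U z) (fun z => star (f z) * V z) := by
  rw [inner_toeplitz, inner_mulOp, ← integral_bergman_eq_heatForm ht
    (φ := fun z => g z * U z) (ψ := fun z => star (f z) * V z) (hgc.mul hU) cg.mul_right
    (hfc.star.mul hV) (cf.comp_left (g := star) (star_zero _)).mul_right]
  have h1 := coeFn_orthogonalProjectionOnto_fock ht (mulOp n t g hg (u : L2 n t))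
  refine integral_congr_ae ?_
  filter_upwards [h1, hvV] with w hw hv
  have h2 : ((toeplitz n t g hg u : fock n t) : L2 n t) w =
      ∫ z, g z * U z * Complex.exp ((∑ k, w k * star (z k)) / t) ∂(gaussian n t) := by
    refine hw.trans (integral_congr_ae ?_)
    filter_upwards [coeFn_mulOp n t hg (u : L2 n t), huU] with z h3 h4
    rw [h3, h4]
  rw [h2, hv, star_mul', star_star]
  ring

theorem inner_toeplitz_eq {n : ℕ} {t : ℝ} {f : (Fin n → ℂ) → ℂ} (hf : IsSymbol f)
    (u v : fock n t) {U V : (Fin n → ℂ) → ℂ} (huU : (u : L2 n t) =ᵐ[gaussian n t] U)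
    (hvV : (v : L2 n t) =ᵐ[gaussian n t] V) :
    inner ℂ v (toeplitz n t f hf u) = ∫ z, f z * U z * star (V z) ∂(gaussian n t) := by
  rw [inner_toeplitz, inner_mulOp]
  refine integral_congr_ae ?_
  filter_upwards [huU, hvV] with z h1 h2
  rw [h1, h2]

/-- The symbol of the first order term of the composition of two Toeplitz operators. -/
def wickSymbol {n : ℕ} (f g : (Fin n → ℂ) → ℂ) (z : Fin n → ℂ) : ℂ :=
  ∑ j, dz j f z * dzbar j g z

/-- The Taylor estimate for `φ = g U` and `ψ = f̄ V`. In the constant, `n²` counts the pairs `(j,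
k)`, `2^n` comes from the Schur test, and its `1/2` cancels the `2` of `norm_le_of_norm_inner_le`.
-/
theorem norm_toeplitz_mul_sub_le_of_hasCompactSupport {n : ℕ} {t : ℝ} (ht : 0 < t)
    {f g : (Fin n → ℂ) → ℂ} (hf : ContDiff ℝ 2 f) (hg : ContDiff ℝ 2 g)
    (cf : HasCompactSupport f) (cg : HasCompactSupport g) (sf : IsSymbol f) (sg : IsSymbol g)
    (sfg : IsSymbol fun z => f z * g z) (sw : IsSymbol (wickSymbol f g)) {A : ℝ}
    (hA : ∀ j k z, ‖dzbar k (dzbar j g) z‖ ≤ A)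
    (hA' : ∀ j k z, ‖dzbar k (dzbar j fun z => star (f z)) z‖ ≤ A) :
    ‖toeplitz n t f sf * toeplitz n t g sg - toeplitz n t _ sfg
      + (t : ℂ) • toeplitz n t _ sw‖ ≤ n ^ 2 * 2 ^ n * A ^ 2 * t ^ 2 := by
  have hstar : ContDiff ℝ 2 fun z => star (f z) := (starL' ℝ (A := ℂ)).contDiff.comp hf
  have key : ∀ u v : fock n t, ‖inner ℂ v ((toeplitz n t f sf * toeplitz n t g sg
      - toeplitz n t _ sfg + (t : ℂ) • toeplitz n t _ sw) u)‖ ≤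
      (n ^ 2 * (2 ^ n / 2) * A ^ 2 * t ^ 2) * (‖u‖ ^ 2 + ‖v‖ ^ 2) := by
    intro u v
    obtain ⟨U, hU, huU⟩ := u.2
    obtain ⟨V, hV, hvV⟩ := v.2
    have U1 := contDiff_entire hU
    have V1 := contDiff_entire hV
    set φ := fun z => g z * U z with hφ
    set ψ := fun z => star (f z) * V z with hψ
    have φ1 : ContDiff ℝ 1 φ := (hg.of_le one_le_two).mul U1
    have ψ1 : ContDiff ℝ 1 ψ := (hstar.of_le one_le_two).mul V1
    have cφ : HasCompactSupport φ := cg.mul_right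
    have cψ : HasCompactSupport ψ := (cf.comp_left (g := star) (star_zero _)).mul_right
    have dφ : ∀ j, dzbar j φ = fun z => dzbar j g z * U z :=
      dzbar_mul_entire (hg.differentiable two_ne_zero) hU
    have dψ : ∀ j, dzbar j ψ = fun z => dzbar j (fun z => star (f z)) z * V z :=
      dzbar_mul_entire (hstar.differentiable two_ne_zero) hV
    have dφ1 : ∀ j, ContDiff ℝ 1 (dzbar j φ) := fun j => by
      rw [dφ]
      exact (contDiff_dzbar hg j).mul U1
    have dψ1 : ∀ j, ContDiff ℝ 1 (dzbar j ψ) := fun j => by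
      rw [dψ]
      exact (contDiff_dzbar hstar j).mul V1
    have ddφ : ∀ j k, dzbar k (dzbar j φ) = fun z => dzbar k (dzbar j g) z * U z := fun j k => by
      rw [dφ]
      exact dzbar_mul_entire ((contDiff_dzbar hg j).differentiable one_ne_zero) hU k
    have ddψ : ∀ j k, dzbar k (dzbar j ψ) =
        fun z => dzbar k (dzbar j fun z => star (f z)) z * V z := fun j k => by
      rw [dψ]
      exact dzbar_mul_entire ((contDiff_dzbar hstar j).differentiable one_ne_zero) hV k
    have bound : ∀ (w : fock n t) {a W : (Fin n → ℂ) → ℂ}, (w : L2 n t) =ᵐ[gaussian n t] W →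
        (∀ z, ‖a z‖ ≤ A) → ∫ z, ‖a z * W z‖ ^ 2 ∂(gaussian n t) ≤ A ^ 2 * ‖w‖ ^ 2 := by
      intro w a W hW ha
      have hi : Integrable (fun z => ‖W z‖ ^ 2) (gaussian n t) := by
        have hm : MemLp W 2 (gaussian n t) := (memLp_congr_ae hW).1 (Lp.memLp _)
        exact (memLp_two_iff_integrable_sq_norm hm.1).1 hm
      rw [Submodule.coe_norm, norm_sq_eq_integral _ hW, ← integral_const_mul]
      refine integral_mono_of_nonneg (ae_of_all _ fun z => by positivity) (hi.const_mul _)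
        (ae_of_all _ fun z => ?_)
      simp only [norm_mul, mul_pow]
      gcongr
      exact ha z
    have e : inner ℂ v ((toeplitz n t f sf * toeplitz n t g sg
        - toeplitz n t _ sfg + (t : ℂ) • toeplitz n t _ sw) u) =
        heatForm n t t φ ψ - ∫ z, φ z * star (ψ z) ∂(gaussian n t)
        + t * ∑ j, ∫ z, dzbar j φ z * star (dzbar j ψ z) ∂(gaussian n t) := by
      simp only [add_apply, sub_apply,
        smul_apply, mul_apply_eq_comp, inner_add_right,
        inner_sub_right]
      have hsm : ∀ x : fock n t, inner ℂ v ((t : ℂ) • x) = (t : ℂ) * inner ℂ v x := fun x =>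
        inner_smul_right v x (t : ℂ)
      rw [hsm]
      rw [inner_toeplitz_toeplitz ht sf sg hf.continuous cf hg.continuous cg u v U1.continuous
        V1.continuous huU hvV, inner_toeplitz_eq sfg u v huU hvV, inner_toeplitz_eq sw u v huU hvV]
      congr 1
      · congr 1
        refine integral_congr_ae (ae_of_all _ fun z => ?_)
        simp only [hφ, hψ, star_mul', star_star]
        ring
      · have := isProbabilityMeasure_gaussian n ht
        congr 1
        rw [← integral_finsetSum]
        · refine integral_congr_ae (ae_of_all _ fun z => ?_)
          simp only [wickSymbol, dφ, dψ, Finset.sum_mul]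
          refine Finset.sum_congr rfl fun j _ => ?_
          rw [dzbar_star (hf.differentiable two_ne_zero), star_mul', star_star]
          ring
        · intro j _
          refine ((dφ1 j).continuous.mul (dψ1 j).continuous.star).integrable_of_hasCompactSupport ?_
          exact (hasCompactSupport_dzbar cφ j).mul_right
    rw [e]
    refine (norm_heatForm_sub_taylor_le ht φ1 cφ ψ1 cψ dφ1 dψ1).trans ?_
    have hsum : ∑ j, ∑ k, 2 ^ n / 2 * ((∫ z, ‖dzbar k (dzbar j φ) z‖ ^ 2 ∂(gaussian n t)) +
        ∫ z, ‖dzbar k (dzbar j ψ) z‖ ^ 2 ∂(gaussian n t)) ≤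
        ∑ _j : Fin n, ∑ _k : Fin n, 2 ^ n / 2 * (A ^ 2 * ‖u‖ ^ 2 + A ^ 2 * ‖v‖ ^ 2) := by
      gcongr with j _ k _
      · rw [ddφ]
        exact bound u huU (hA j k)
      · rw [ddψ]
        exact bound v hvV (hA' j k)
    simp only [Finset.sum_const, Finset.card_univ, Fintype.card_fin, nsmul_eq_mul] at hsum
    calc _ ≤ (n * (n * (2 ^ n / 2 * (A ^ 2 * ‖u‖ ^ 2 + A ^ 2 * ‖v‖ ^ 2)))) * t * t := by gcongr
      _ = _ := by ring
  refine (norm_le_of_norm_inner_le (by positivity) key).trans (le_of_eq ?_)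
  ring

/-! ### Cutoffs -/

theorem norm_dz_le {n : ℕ} (φ : (Fin n → ℂ) → ℂ) (j : Fin n) (z : Fin n → ℂ) :
    ‖dz j φ z‖ ≤ ‖fderiv ℝ φ z‖ := by
  have h : ∀ c : ℂ, ‖c‖ = 1 → ‖fderiv ℝ φ z (Pi.single j c)‖ ≤ ‖fderiv ℝ φ z‖ := fun c hc => by
    simpa [Pi.norm_single, hc] using (fderiv ℝ φ z).le_opNorm (Pi.single j c)
  rw [dz, norm_div, Complex.norm_two, div_le_iff₀ two_pos]
  refine (norm_sub_le _ _).trans ?_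
  rw [norm_mul, Complex.norm_I, one_mul]
  linarith [h 1 (by simp), h Complex.I (by simp)]

theorem norm_dzbar_le {n : ℕ} (φ : (Fin n → ℂ) → ℂ) (j : Fin n) (z : Fin n → ℂ) :
    ‖dzbar j φ z‖ ≤ ‖fderiv ℝ φ z‖ := by
  have h : ∀ c : ℂ, ‖c‖ = 1 → ‖fderiv ℝ φ z (Pi.single j c)‖ ≤ ‖fderiv ℝ φ z‖ := fun c hc => by
    simpa [Pi.norm_single, hc] using (fderiv ℝ φ z).le_opNorm (Pi.single j c)
  rw [dzbar, norm_div, Complex.norm_two, div_le_iff₀ two_pos]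
  refine (norm_add_le _ _).trans ?_
  rw [norm_mul, Complex.norm_I, one_mul]
  linarith [h 1 (by simp), h Complex.I (by simp)]

theorem norm_dzbar_dzbar_le {n : ℕ} {φ : (Fin n → ℂ) → ℂ} (hφ : ContDiff ℝ 2 φ) (j k : Fin n)
    (z : Fin n → ℂ) : ‖dzbar k (dzbar j φ) z‖ ≤ ‖iteratedFDeriv ℝ 2 φ z‖ := by
  refine (norm_dzbar_le _ k z).trans ?_
  have hd : HasFDerivAt (fderiv ℝ φ) (fderiv ℝ (fderiv ℝ φ) z) z :=
    ((hφ.fderiv_right (m := 1) (by norm_num)).differentiable one_ne_zero z).hasFDerivAt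
  have hv : ∀ v : Fin n → ℂ, HasFDerivAt (fun z => fderiv ℝ φ z v)
      ((fderiv ℝ (fderiv ℝ φ) z).flip v) z := fun v => by
    simpa using hd.clm_apply (hasFDerivAt_const v z)
  have h := ((hv (Pi.single j 1)).fun_add ((hv (Pi.single j Complex.I)).const_mul
    Complex.I)).mul_const (2⁻¹ : ℂ)
  have e : dzbar j φ = fun z => (fderiv ℝ φ z (Pi.single j 1) +
    Complex.I * fderiv ℝ φ z (Pi.single j Complex.I)) * 2⁻¹ := rfl
  have hn : ‖fderiv ℝ (fderiv ℝ φ) z‖ = ‖iteratedFDeriv ℝ 2 φ z‖ := by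
    rw [← norm_iteratedFDeriv_one, norm_iteratedFDeriv_fderiv]
  have hb : ∀ c : ℂ, ‖c‖ = 1 →
      ‖(fderiv ℝ (fderiv ℝ φ) z).flip (Pi.single j c)‖ ≤ ‖iteratedFDeriv ℝ 2 φ z‖ := fun c hc => by
    have := (fderiv ℝ (fderiv ℝ φ) z).flip.le_opNorm (Pi.single j c)
    rwa [ContinuousLinearMap.opNorm_flip, hn, Pi.norm_single, hc, mul_one] at this
  rw [e, HasFDerivAt.fderiv h, norm_smul, norm_inv, Complex.norm_two]
  have h3 : ‖(fderiv ℝ (fderiv ℝ φ) z).flip (Pi.single j 1) +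
      Complex.I • (fderiv ℝ (fderiv ℝ φ) z).flip (Pi.single j Complex.I)‖ ≤
      2 * ‖iteratedFDeriv ℝ 2 φ z‖ := by
    refine (norm_add_le _ _).trans ?_
    rw [norm_smul, Complex.norm_I, one_mul]
    linarith [hb 1 (by simp), hb Complex.I (by simp)]
  linarith

/-- Smooth compactly supported functions, equal to one on larger and larger balls, with uniformly
bounded derivatives. -/
theorem exists_cutoff (n : ℕ) : ∃ χ : ℕ → (Fin n → ℂ) → ℂ, (∀ m, ContDiff ℝ 2 (χ m)) ∧
    (∀ m, HasCompactSupport (χ m)) ∧ (∀ z, ∀ᶠ m in atTop, χ m =ᶠ[𝓝 z] fun _ => 1) ∧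
    ∀ i : ℕ, ∃ C, ∀ m z, ‖iteratedFDeriv ℝ i (χ m) z‖ ≤ C := by
  let b : ContDiffBump (0 : Fin n → ℂ) := ⟨1, 2, one_pos, one_lt_two⟩
  let p : (Fin n → ℂ) → ℂ := fun z => (b z : ℂ)
  have hp : ∀ k : ℕ, ContDiff ℝ k p := fun k => Complex.ofRealCLM.contDiff.comp b.contDiff
  have cp : HasCompactSupport p :=
    b.hasCompactSupport.comp_left (g := fun x : ℝ => (x : ℂ)) Complex.ofReal_zero
  let ε : ℕ → ℝ := fun m => 1 / ((m : ℝ) + 1)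
  have hε : ∀ m, 0 < ε m := fun m => Nat.one_div_pos_of_nat
  -- Since `ε m ≤ 1`, each `S m` has norm at most one, so composing with it does not increase the
  -- sup norms of the derivatives of `p`.
  have hε1 : ∀ m, ε m ≤ 1 := fun m => by
    rw [div_le_one (by positivity)]
    linarith [(Nat.cast_nonneg m : (0 : ℝ) ≤ m)]
  let S : ℕ → (Fin n → ℂ) →L[ℝ] (Fin n → ℂ) := fun m => ε m • ContinuousLinearMap.id ℝ _
  have hS : ∀ m, ‖S m‖ ≤ 1 := fun m => by
    rw [norm_smul, Real.norm_eq_abs, abs_of_pos (hε m)]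
    exact mul_le_one₀ (hε1 m) (norm_nonneg _) ContinuousLinearMap.norm_id_le
  refine ⟨fun m => p ∘ S m, fun m => ?_, fun m => ?_, fun z => ?_, fun i => ?_⟩
  · exact (hp 2).comp (S m).contDiff
  · have h : HasCompactSupport fun z => p (ε m • z) := HasCompactSupport.comp_smul cp (hε m).ne'
    exact h
  · have h0 : Tendsto (fun m => S m z) atTop (𝓝 0) := by
      have := (tendsto_one_div_add_atTop_nhds_zero_nat (𝕜 := ℝ)).smul_const z
      rwa [zero_smul] at this
    filter_upwards [h0.eventually (Metric.ball_mem_nhds (0 : Fin n → ℂ) one_pos)] with m hm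
    have h1 : ∀ᶠ y in 𝓝 z, S m y ∈ Metric.ball (0 : Fin n → ℂ) 1 :=
      (S m).continuous.continuousAt.eventually (Metric.isOpen_ball.mem_nhds hm)
    filter_upwards [h1] with y hy
    simp only [Function.comp_apply, p]
    rw [b.one_of_mem_closedBall (Metric.ball_subset_closedBall hy), Complex.ofReal_one]
  · obtain ⟨C, hC⟩ := ((hp i).continuous_iteratedFDeriv le_rfl).bounded_above_of_compact_support
      (cp.iteratedFDeriv (𝕜 := ℝ) i)
    refine ⟨C, fun m z => ?_⟩
    rw [(S m).iteratedFDeriv_comp_right (hp i) z (i := i) le_rfl]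
    refine (ContinuousMultilinearMap.norm_compContinuousLinearMap_le _ _).trans ?_
    refine (mul_le_of_le_one_right (norm_nonneg _) ?_).trans (hC _)
    exact Finset.prod_le_one (fun _ _ => norm_nonneg _) fun _ _ => hS m

/-- Leibniz' formula; the point is that `K` does not depend on `m`. -/
theorem exists_norm_iteratedFDeriv_cutoff_mul_le {n k : ℕ} {χ : ℕ → (Fin n → ℂ) → ℂ}
    (hχ : ∀ m, ContDiff ℝ k (χ m)) (hC : ∀ i : ℕ, ∃ C, ∀ m z, ‖iteratedFDeriv ℝ i (χ m) z‖ ≤ C)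
    {f : (Fin n → ℂ) → ℂ} (hf : IsCb k f) :
    ∃ K, ∀ m, ∀ i ≤ k, ∀ z, ‖iteratedFDeriv ℝ i (fun z => χ m z * f z) z‖ ≤ K := by
  choose C hC using hC
  have hD : ∀ i, ∃ D, ∀ z, i ≤ k → ‖iteratedFDeriv ℝ i f z‖ ≤ D := fun i => by
    by_cases hi : i ≤ k
    · obtain ⟨D, hD⟩ := hf.2 i hi
      exact ⟨D, fun z _ => hD z⟩
    -- Beyond order `k` the bound is vacuous; the value `0` only makes `D` total.
    · exact ⟨0, fun z h => absurd h hi⟩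
  choose D hD using hD
  have hC0 : ∀ i, 0 ≤ C i := fun i => (norm_nonneg _).trans (hC i 0 0)
  let B : ℕ → ℝ := fun i => ∑ l ∈ Finset.range (i + 1), (i.choose l : ℝ) * C l * D (i - l)
  have hB : ∀ m, ∀ i ≤ k, ∀ z, ‖iteratedFDeriv ℝ i (fun z => χ m z * f z) z‖ ≤ B i := by
    intro m i hi z
    refine (norm_iteratedFDeriv_mul_le (hχ m) hf.1 z (by exact_mod_cast hi)).trans ?_
    refine Finset.sum_le_sum fun l hl => ?_
    have := hC0 l
    gcongr
    · exact hC l m z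
    · exact hD (i - l) z (by omega)
  refine ⟨∑ i ∈ Finset.range (k + 1), B i, fun m i hi z => (hB m i hi z).trans ?_⟩
  exact Finset.single_le_sum (f := B) (fun i hi => (norm_nonneg _).trans
    (hB 0 i (Nat.lt_succ_iff.1 (Finset.mem_range.1 hi)) 0))
    (Finset.mem_range.2 (Nat.lt_succ_of_le hi))

theorem norm_mulOp_le {n : ℕ} {t : ℝ} {f : (Fin n → ℂ) → ℂ} (hf : IsSymbol f) {K : ℝ}
    (hK : ∀ z, ‖f z‖ ≤ K) (φ : L2 n t) : ‖mulOp n t f hf φ‖ ≤ K * ‖φ‖ := by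
  have hK0 : 0 ≤ K := (norm_nonneg _).trans (hK 0)
  refine le_of_sq_le_sq ?_ (by positivity)
  have hi : Integrable (fun z => ‖φ z‖ ^ 2) (gaussian n t) :=
    (memLp_two_iff_integrable_sq_norm (Lp.memLp φ).1).1 (Lp.memLp φ)
  rw [norm_sq_eq_integral _ (coeFn_mulOp n t hf φ), mul_pow, norm_sq_eq_integral φ (ae_eq_refl _),
    ← integral_const_mul]
  refine integral_mono_of_nonneg (ae_of_all _ fun z => by positivity) (hi.const_mul _)
    (ae_of_all _ fun z => ?_)
  simp only [norm_mul, mul_pow]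
  gcongr
  exact hK z

theorem norm_toeplitz_le {n : ℕ} {t : ℝ} {f : (Fin n → ℂ) → ℂ} (hf : IsSymbol f) {K : ℝ}
    (hK : ∀ z, ‖f z‖ ≤ K) (u : fock n t) : ‖toeplitz n t f hf u‖ ≤ K * ‖u‖ :=
  ((fock n t).norm_orthogonalProjectionOnto_apply_le _).trans (norm_mulOp_le hf hK _)

/-- Dominated convergence in `L²_t`. Only strong convergence is asserted: the truncated symbols need
not converge uniformly. -/
theorem tendsto_mulOp {n : ℕ} {t : ℝ} {s : ℕ → (Fin n → ℂ) → ℂ} {f : (Fin n → ℂ) → ℂ}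
    (hs : ∀ m, IsSymbol (s m)) (hf : IsSymbol f) {K : ℝ} (hK : ∀ m z, ‖s m z‖ ≤ K)
    (hlim : ∀ z, ∀ᶠ m in atTop, s m z = f z) (φ : L2 n t) :
    Tendsto (fun m => mulOp n t (s m) (hs m) φ) atTop (𝓝 (mulOp n t f hf φ)) := by
  have hi : Integrable (fun z => ‖φ z‖ ^ 2) (gaussian n t) :=
    (memLp_two_iff_integrable_sq_norm (Lp.memLp φ).1).1 (Lp.memLp φ)
  have hKf : ∀ z, ‖f z‖ ≤ K := fun z => by
    obtain ⟨m, hm⟩ := (hlim z).exists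
    rw [← hm]
    exact hK m z
  have hsq : Tendsto (fun m => ‖mulOp n t (s m) (hs m) φ - mulOp n t f hf φ‖ ^ 2) atTop (𝓝 0) := by
    have e : ∀ m, ‖mulOp n t (s m) (hs m) φ - mulOp n t f hf φ‖ ^ 2 =
        ∫ z, ‖(s m z - f z) * φ z‖ ^ 2 ∂(gaussian n t) := fun m => by
      refine norm_sq_eq_integral _ ?_
      filter_upwards [Lp.coeFn_sub (mulOp n t (s m) (hs m) φ) (mulOp n t f hf φ),
        coeFn_mulOp n t (hs m) φ, coeFn_mulOp n t hf φ] with z h1 h2 h3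
      rw [h1, Pi.sub_apply, h2, h3, sub_mul]
    simp only [e]
    have h0 : ∫ _z : Fin n → ℂ, (0 : ℝ) ∂(gaussian n t) = 0 := integral_zero _ _
    rw [← h0]
    refine tendsto_integral_of_dominated_convergence (fun z => (2 * K) ^ 2 * ‖φ z‖ ^ 2) ?_
      (hi.const_mul _) ?_ ?_
    · intro m
      exact ((((hs m).1.sub hf.1).aestronglyMeasurable.mul (Lp.memLp φ).1).norm.pow 2)
    · refine fun m => ae_of_all _ fun z => ?_
      rw [Real.norm_eq_abs, abs_of_nonneg (by positivity), norm_mul, mul_pow]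
      gcongr
      exact (norm_sub_le _ _).trans (by linarith [hK m z, hKf z])
    · refine ae_of_all _ fun z => tendsto_const_nhds.congr' ?_
      filter_upwards [hlim z] with m hm
      simp [hm]
  rw [tendsto_iff_norm_sub_tendsto_zero]
  have := hsq.sqrt
  simpa [Real.sqrt_sq] using this

theorem tendsto_toeplitz {n : ℕ} {t : ℝ} {s : ℕ → (Fin n → ℂ) → ℂ} {f : (Fin n → ℂ) → ℂ}
    (hs : ∀ m, IsSymbol (s m)) (hf : IsSymbol f) {K : ℝ} (hK : ∀ m z, ‖s m z‖ ≤ K)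
    (hlim : ∀ z, ∀ᶠ m in atTop, s m z = f z) (u : fock n t) :
    Tendsto (fun m => toeplitz n t (s m) (hs m) u) atTop (𝓝 (toeplitz n t f hf u)) :=
  ((fock n t).orthogonalProjectionOnto.continuous.tendsto _).comp
    (tendsto_mulOp hs hf hK hlim (u : L2 n t))

/-- Multiplication is jointly continuous for strong convergence on norm bounded sets; `K` bounds the
left factors. -/
theorem tendsto_toeplitz_toeplitz {n : ℕ} {t : ℝ} {r s : ℕ → (Fin n → ℂ) → ℂ}
    {f g : (Fin n → ℂ) → ℂ} (hr : ∀ m, IsSymbol (r m)) (hf : IsSymbol f)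
    (hs : ∀ m, IsSymbol (s m)) (hg : IsSymbol g) {K L : ℝ}
    (hK : ∀ m z, ‖r m z‖ ≤ K) (hlimr : ∀ z, ∀ᶠ m in atTop, r m z = f z)
    (hL : ∀ m z, ‖s m z‖ ≤ L) (hlims : ∀ z, ∀ᶠ m in atTop, s m z = g z) (u : fock n t) :
    Tendsto (fun m => toeplitz n t (r m) (hr m) (toeplitz n t (s m) (hs m) u)) atTop
      (𝓝 (toeplitz n t f hf (toeplitz n t g hg u))) := by
  have h1 := tendsto_toeplitz hr hf hK hlimr (toeplitz n t g hg u)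
  have h2 := tendsto_toeplitz hs hg hL hlims u
  have h3 : Tendsto (fun m => toeplitz n t (r m) (hr m)
      (toeplitz n t (s m) (hs m) u - toeplitz n t g hg u)) atTop (𝓝 0) := by
    have h4 : Tendsto (fun m => K * ‖toeplitz n t (s m) (hs m) u - toeplitz n t g hg u‖) atTop
        (𝓝 0) := by
      simpa using (tendsto_iff_norm_sub_tendsto_zero.1 h2).const_mul K
    exact squeeze_zero_norm (fun m => norm_toeplitz_le (hr m) (hK m) _) h4
  have h5 := h3.add h1
  rw [zero_add] at h5
  refine h5.congr fun m => ?_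
  rw [map_sub, sub_add_cancel]

/-! ### The second order estimate for bounded symbols and the quantization limit -/

theorem isSymbol_wickSymbol {n k : ℕ} {f g : (Fin n → ℂ) → ℂ} (hk : 1 ≤ k) (hf : IsCb k f)
    (hg : IsCb k g) : IsSymbol (wickSymbol f g) :=
  IsSymbol.sum _ fun j => (hf.isSymbol_dz hk j).mul (hg.isSymbol_dzbar hk j)

theorem norm_wickSymbol_le {n : ℕ} {f g : (Fin n → ℂ) → ℂ} {z : Fin n → ℂ} {K L : ℝ}
    (hf : ‖fderiv ℝ f z‖ ≤ K) (hg : ‖fderiv ℝ g z‖ ≤ L) : ‖wickSymbol f g z‖ ≤ n * (K * L) := by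
  have hK : 0 ≤ K := (norm_nonneg _).trans hf
  have h : ∀ j ∈ (Finset.univ : Finset (Fin n)), ‖dz j f z * dzbar j g z‖ ≤ K * L := fun j _ => by
    rw [norm_mul]
    exact mul_le_mul ((norm_dz_le f j z).trans hf) ((norm_dzbar_le g j z).trans hg)
      (norm_nonneg _) hK
  refine (norm_sum_le_of_le _ h).trans (le_of_eq ?_)
  simp

/-- An operator norm bound that is uniform in `m` passes to strong limits, vector by vector. -/
theorem exists_norm_toeplitz_mul_sub_le {n : ℕ} {f g : (Fin n → ℂ) → ℂ} (hf : IsCb 2 f)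
    (hg : IsCb 2 g) : ∃ C, ∀ t : ℝ, 0 < t →
    ‖toeplitz n t f hf.isSymbol * toeplitz n t g hg.isSymbol
      - toeplitz n t _ (hf.isSymbol.mul hg.isSymbol)
      + (t : ℂ) • toeplitz n t _ (isSymbol_wickSymbol one_le_two hf hg)‖ ≤ C * t ^ 2 := by
  obtain ⟨χ, hχ, cχ, hχ1, hχC⟩ := exists_cutoff n
  obtain ⟨K, hK⟩ := exists_norm_iteratedFDeriv_cutoff_mul_le hχ hχC hf
  obtain ⟨L, hL⟩ := exists_norm_iteratedFDeriv_cutoff_mul_le hχ hχC hg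
  set r : ℕ → (Fin n → ℂ) → ℂ := fun m z => χ m z * f z with hr
  set s : ℕ → (Fin n → ℂ) → ℂ := fun m z => χ m z * g z with hs
  have r2 : ∀ m, IsCb 2 (r m) := fun m => ⟨(hχ m).mul hf.1, fun i hi => ⟨K, hK m i hi⟩⟩
  have s2 : ∀ m, IsCb 2 (s m) := fun m => ⟨(hχ m).mul hg.1, fun i hi => ⟨L, hL m i hi⟩⟩
  have cr : ∀ m, HasCompactSupport (r m) := fun m => (cχ m).mul_right
  have cs : ∀ m, HasCompactSupport (s m) := fun m => (cχ m).mul_right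
  have r0 : ∀ m z, ‖r m z‖ ≤ K := fun m z => by
    rw [← norm_iteratedFDeriv_zero (𝕜 := ℝ)]
    exact hK m 0 (by norm_num) z
  have s0 : ∀ m z, ‖s m z‖ ≤ L := fun m z => by
    rw [← norm_iteratedFDeriv_zero (𝕜 := ℝ)]
    exact hL m 0 (by norm_num) z
  have r1 : ∀ m z, ‖fderiv ℝ (r m) z‖ ≤ K := fun m z => by
    rw [← norm_iteratedFDeriv_one]
    exact hK m 1 one_le_two z
  have s1 : ∀ m z, ‖fderiv ℝ (s m) z‖ ≤ L := fun m z => by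
    rw [← norm_iteratedFDeriv_one]
    exact hL m 1 one_le_two z
  have er : ∀ z, ∀ᶠ m in atTop, r m =ᶠ[𝓝 z] f := fun z => by
    filter_upwards [hχ1 z] with m hm
    filter_upwards [hm] with y hy
    simp only [hr, hy, one_mul]
  have es : ∀ z, ∀ᶠ m in atTop, s m =ᶠ[𝓝 z] g := fun z => by
    filter_upwards [hχ1 z] with m hm
    filter_upwards [hm] with y hy
    simp only [hs, hy, one_mul]
  -- Derivatives are involved, so agreement on a neighbourhood of `z` is needed, not only at `z`.
  have ersw : ∀ z, ∀ᶠ m in atTop, wickSymbol (r m) (s m) z = wickSymbol f g z := fun z => by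
    filter_upwards [er z, es z] with m h1 h2
    simp only [wickSymbol, dz, dzbar, h1.fderiv_eq, h2.fderiv_eq]
  refine ⟨n ^ 2 * 2 ^ n * max K L ^ 2, fun t ht => ?_⟩
  refine ContinuousLinearMap.opNorm_le_bound _ (by positivity) fun u => ?_
  have l1 := tendsto_toeplitz_toeplitz (t := t) (fun m => (r2 m).isSymbol) hf.isSymbol
    (fun m => (s2 m).isSymbol) hg.isSymbol r0 (fun z => (er z).mono fun m hm => hm.eq_of_nhds) s0
    (fun z => (es z).mono fun m hm => hm.eq_of_nhds) u
  have l2 := tendsto_toeplitz (t := t) (fun m => (r2 m).isSymbol.mul (s2 m).isSymbol)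
    (hf.isSymbol.mul hg.isSymbol) (K := K * L) (fun m z => by
      rw [norm_mul]
      exact mul_le_mul (r0 m z) (s0 m z) (norm_nonneg _) ((norm_nonneg _).trans (r0 m z)))
    (fun z => by
      filter_upwards [er z, es z] with m h1 h2
      rw [h1.eq_of_nhds, h2.eq_of_nhds]) u
  have l3 := tendsto_toeplitz (t := t) (fun m => isSymbol_wickSymbol one_le_two (r2 m) (s2 m))
    (isSymbol_wickSymbol one_le_two hf hg) (fun m z => norm_wickSymbol_le (r1 m z) (s1 m z)) ersw u
  refine le_of_tendsto ((l1.sub l2).add (l3.const_smul (t : ℂ))).norm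
    (Eventually.of_forall fun m => ?_)
  have hstar : ContDiff ℝ 2 fun z => star (r m z) := (starL' ℝ (A := ℂ)).contDiff.comp (r2 m).1
  have key := norm_toeplitz_mul_sub_le_of_hasCompactSupport ht (r2 m).1 (s2 m).1 (cr m) (cs m)
    (r2 m).isSymbol (s2 m).isSymbol ((r2 m).isSymbol.mul (s2 m).isSymbol)
    (isSymbol_wickSymbol one_le_two (r2 m) (s2 m)) (A := max K L)
    (fun j k z => (norm_dzbar_dzbar_le (s2 m).1 j k z).trans
      ((hL m 2 le_rfl z).trans (le_max_right _ _)))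
    (fun j k z => by
      refine (norm_dzbar_dzbar_le hstar j k z).trans (le_trans (le_of_eq ?_)
        ((hK m 2 le_rfl z).trans (le_max_left _ _)))
      -- Conjugation is a real linear isometry, so `f̄` obeys the same derivative bounds as `f`.
      exact Complex.conjLIE.norm_iteratedFDeriv_comp_left (r m) z 2)
  exact ContinuousLinearMap.le_of_opNorm_le _ key u

theorem toeplitz_congr {n : ℕ} {t : ℝ} {f g : (Fin n → ℂ) → ℂ} (hf : IsSymbol f)
    (hg : IsSymbol g) (h : f = g) : toeplitz n t f hf = toeplitz n t g hg := by
  subst h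
  rfl

theorem toeplitz_eq_smul_sub {n : ℕ} {t : ℝ} {f g h : (Fin n → ℂ) → ℂ} (hf : IsSymbol f)
    (hg : IsSymbol g) (hh : IsSymbol h) {c : ℂ} (e : ∀ z, h z = c * (f z - g z)) :
    toeplitz n t h hh = c • (toeplitz n t f hf - toeplitz n t g hg) := by
  have hm : mulOp n t h hh = c • (mulOp n t f hf - mulOp n t g hg) := by
    ext1 φ
    refine Lp.ext ?_
    filter_upwards [coeFn_mulOp n t hh φ, coeFn_mulOp n t hf φ, coeFn_mulOp n t hg φ,
      Lp.coeFn_smul c (mulOp n t f hf φ - mulOp n t g hg φ),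
      Lp.coeFn_sub (mulOp n t f hf φ) (mulOp n t g hg φ)] with z h1 h2 h3 h4 h5
    refine h1.trans (Eq.trans ?_ h4.symm)
    rw [Pi.smul_apply, h5, Pi.sub_apply, h2, h3, e, smul_eq_mul]
    ring
  ext1 u
  have h1 := map_smul (fock n t).orthogonalProjectionOnto c
    (mulOp n t f hf (u : L2 n t) - mulOp n t g hg (u : L2 n t))
  rw [map_sub] at h1
  simp only [toeplitz, hm]
  exact h1

end FockToeplitz

end

/-! ### The commutator estimate -/

open FockToeplitz in
theorem corollary2 (n : ℕ) (f g : (Fin n → ℂ) → ℂ) (hf : IsCb 2 f) (hg : IsCb 2 g) :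
    (fun t : ℝ =>
      ‖(toeplitz n t f hf.isSymbol * toeplitz n t g hg.isSymbol
          - toeplitz n t g hg.isSymbol * toeplitz n t f hf.isSymbol)
        - (Complex.I * (t : ℂ)) • toeplitz n t (poissonBracket f g)
            (isSymbol_poissonBracket one_le_two hf hg)‖)
      =o[𝓝[>] (0 : ℝ)] (fun t : ℝ => t) := by
  obtain ⟨C, hC⟩ := exists_norm_toeplitz_mul_sub_le hf hg
  obtain ⟨D, hD⟩ := exists_norm_toeplitz_mul_sub_le hg hf
  have hbound : ∀ t : ℝ, 0 < t →
      ‖(toeplitz n t f hf.isSymbol * toeplitz n t g hg.isSymbol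
          - toeplitz n t g hg.isSymbol * toeplitz n t f hf.isSymbol)
        - (Complex.I * (t : ℂ)) • toeplitz n t (poissonBracket f g)
            (isSymbol_poissonBracket one_le_two hf hg)‖ ≤ (C + D) * t ^ 2 := by
    intro t ht
    have e1 : toeplitz n t (poissonBracket f g) (isSymbol_poissonBracket one_le_two hf hg) =
        Complex.I • (toeplitz n t _ (isSymbol_wickSymbol one_le_two hf hg) -
          toeplitz n t _ (isSymbol_wickSymbol one_le_two hg hf)) :=
      toeplitz_eq_smul_sub _ _ _ fun z => by
        simp only [poissonBracket, wickSymbol, ← Finset.sum_sub_distrib]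
        congr 1
        refine Finset.sum_congr rfl fun j _ => ?_
        ring
    -- The zeroth order terms of the two products agree and cancel in the commutator.
    have e2 := toeplitz_congr (t := t) (hf.isSymbol.mul hg.isSymbol) (hg.isSymbol.mul hf.isSymbol)
      (funext fun z => mul_comm (f z) (g z))
    -- The factor `i` of the bracket turns `it` into `-t`, matching the sign of the first order term
    -- in the expansion.
    have e3 : Complex.I * (t : ℂ) * Complex.I = -t := by
      linear_combination (t : ℂ) * Complex.I_sq
    have hsub : ∀ A B : fock n t →L[ℂ] fock n t, ‖A - B‖ ≤ ‖A‖ + ‖B‖ := fun A B => norm_sub_le A B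
    have h := (hsub _ _).trans (add_le_add (hC t ht) (hD t ht))
    rw [← add_mul] at h
    refine le_trans (le_of_eq ?_) h
    rw [e1, e2, smul_smul, e3]
    congr 1
    module
  have h1 : (fun t : ℝ =>
      ‖(toeplitz n t f hf.isSymbol * toeplitz n t g hg.isSymbol
          - toeplitz n t g hg.isSymbol * toeplitz n t f hf.isSymbol)
        - (Complex.I * (t : ℂ)) • toeplitz n t (poissonBracket f g)
            (isSymbol_poissonBracket one_le_two hf hg)‖)
      =O[𝓝[>] (0 : ℝ)] (fun t : ℝ => t ^ 2) := by
    refine Asymptotics.IsBigO.of_bound (C + D) ?_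
    filter_upwards [self_mem_nhdsWithin] with t ht
    rw [Real.norm_eq_abs, Real.norm_eq_abs, abs_of_nonneg (sq_nonneg t), abs_of_nonneg]
    · exact hbound t ht
    · exact ContinuousLinearMap.opNorm_nonneg _
  have h2 : (fun t : ℝ => t ^ 2) =o[𝓝 (0 : ℝ)] fun t : ℝ => t := by
    simpa using Asymptotics.isLittleO_pow_pow (𝕜 := ℝ) one_lt_two
  exact h1.trans_isLittleO (h2.mono nhdsWithin_le_nhds)
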